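/- Let $\lambda>-\frac12$, $\mu\ge 0$, $v_{\lambda,\mu}(t)=|t|^{2\mu}(1-t^2)^{\lambda-1/2}$ for $t\in[-1,1]$, and $\sigma=\max(\lambda,\mu)$. For $1\le p<\infty$ let $L_p(v_{\lambda,\mu})$ be the space of complex-valued Lebesgue measurable functions $f$ on $[-1,1]$ with finite norm $\|f\|_{L_p(v_{\lambda,\mu})}=\bigl(\int_{-1}^1|f(t)|^p v_{\lambda,\mu}(t)\,dt\bigr)^{1/p}$. Let $P_n^{(\alpha,\beta)}$ be the Jacobi polynomials and let $\widetilde C_n=\widetilde C_n^{(\lambda,\mu)}$, $n=0,1,\dots$, be the orthonormal generalized Gegenbauer polynomials with respect to $v_{\lambda,\mu}$, $$\widetilde C_{2n}(t)=\widetilde a_{2n}P_n^{(\lambda-1/2,\mu-1/2)}(2t^2-1),\qquad \widetilde a_{2n}=\Bigl(\tfrac{(2n+\lambda+\mu)\Gamma(n+1)\Gamma(n+\lambda+\mu)}{\Gamma(n+\lambda+\frac12)\Gamma(n+\mu+\frac12)}\Bigr)^{1/2},$$ $$\widetilde C_{2n+1}(t)=\widetilde a_{2n+1}\,t\,P_n^{(\lambda-1/2,\mu+1/2)}(2t^2-1),\qquad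 \widetilde a_{2n+1}=\Bigl(\tfrac{(2n+\lambda+\mu+1)\Gamma(n+1)\Gamma(n+\lambda+\mu+1)}{\Gamma(n+\lambda+\frac12)\Gamma(n+\mu+\frac32)}\Bigr)^{1/2},$$ where for $n=0$ the product $(\lambda+\mu)\Gamma(\lambda+\mu)$ is read as $\Gamma(\lambda+\mu+1)$. Put $\hat f_n=\int_{-1}^1 f(t)\,\widetilde C_n(t)\,v_{\lambda,\mu}(t)\,dt$, and for $1<p<\infty$ let $p'$ be defined by $\frac1p+\frac1{p'}=1$. Then there are constants $B_p$, $1<p\le 2$, depending only on $p,\lambda,\mu$, such that the following hold. (a) If $1<p\le2$ and $f\in L_p(v_{\lambda,\mu})$, then the series below converges and $$\Bigl\{\sum_{n=0}^\infty\Bigl((n+1)^{\left(\frac1{p'}-\frac1p\right)\sigma}|\hat f_n|\Bigr)^{p'}\Bigr\}^{1/p'}\le B_p\,\|f\|_{L_p(v_{\lambda,\mu})}.$$ (b) If $2\le q<\infty$ and $\phi$ is a complex-valued function on the non-negative integers with $$\sum_{n=0}^\infty\Bigl((n+1)^{\left(\frac1{q'}-\frac1q\right)\sigma}|\phi(n)|\Bigr)^{q'}<\infty,$$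 then the polynomials $\Phi_N=\sum_{n=0}^N\phi(n)\widetilde C_n$ converge, as $N\to\infty$, in $L_q(v_{\lambda,\mu})$ to a function $f$ satisfying $\hat f_n=\phi(n)$ for $n=0,1,\dots$, and $$\|f\|_{L_q(v_{\lambda,\mu})}\le B_{q'}\Bigl\{\sum_{n=0}^\infty\Bigl((n+1)^{\left(\frac1{q'}-\frac1q\right)\sigma}|\phi(n)|\Bigr)^{q'}\Bigr\}^{1/q'},$$ with the same constants $B_{q'}$ as in (a). -/

import Mathlib

open MeasureTheory Filter Topology

noncomputable section

namespace GenGegenbauer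

/-- The Jacobi polynomial `P_n^{(α,β)}`, as the finite sum
`∑_k (n+α+β+1)_k (α+k+1)_{n-k} / (k! (n-k)!) * ((x-1)/2)^k`,
where `(a)_k` is the Pochhammer symbol. -/
def jacobi (α β : ℝ) (n : ℕ) (x : ℝ) : ℝ :=
  ∑ k ∈ Finset.range (n + 1),
    (ascPochhammer ℝ k).eval ((n : ℝ) + α + β + 1)
      * (ascPochhammer ℝ (n - k)).eval (α + (k : ℝ) + 1)
      / ((k.factorial : ℝ) * ((n - k).factorial : ℝ)) * ((x - 1) / 2) ^ k

/-- The weight `v_{l,m}(t) = |t|^{2m} (1-t^2)^{l-1/2}`, used on `[-1,1]`. -/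
def weight (l m t : ℝ) : ℝ := |t| ^ (2 * m) * (1 - t ^ 2) ^ (l - 1 / 2)

/-- The measure `v_{l,m}(t) dt` on `[-1,1]`. -/
def weightMeasure (l m : ℝ) : Measure ℝ :=
  (volume.restrict (Set.Icc (-1 : ℝ) 1)).withDensity fun t => ENNReal.ofReal (weight l m t)

/-- The normalizing factor of the orthonormal polynomial of degree `2n`. For `n = 0` the product
`(l+m) Γ(l+m)` of the general formula is written as `Γ(l+m+1)`, so that `l + m = 0` is covered. -/
def evenFactor (l m : ℝ) : ℕ → ℝ
  | 0 => √(Real.Gamma (l + m + 1) / (Real.Gamma (l + 1 / 2) * Real.Gamma (m + 1 / 2)))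
  | n + 1 =>
    √((2 * ((n + 1 : ℕ) : ℝ) + l + m) * Real.Gamma (((n + 1 : ℕ) : ℝ) + 1)
        * Real.Gamma (((n + 1 : ℕ) : ℝ) + l + m)
      / (Real.Gamma (((n + 1 : ℕ) : ℝ) + l + 1 / 2) * Real.Gamma (((n + 1 : ℕ) : ℝ) + m + 1 / 2)))

/-- The normalizing factor of the orthonormal polynomial of degree `2n+1`. -/
def oddFactor (l m : ℝ) (n : ℕ) : ℝ :=
  √((2 * (n : ℝ) + l + m + 1) * Real.Gamma ((n : ℝ) + 1) * Real.Gamma ((n : ℝ) + l + m + 1)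
    / (Real.Gamma ((n : ℝ) + l + 1 / 2) * Real.Gamma ((n : ℝ) + m + 3 / 2)))

/-- The orthonormal generalized Gegenbauer polynomial of degree `n`; here `n / 2` is the integer
part of half the degree. -/
def orthoPoly (l m : ℝ) (n : ℕ) (t : ℝ) : ℝ :=
  if Even n then
    evenFactor l m (n / 2) * jacobi (l - 1 / 2) (m - 1 / 2) (n / 2) (2 * t ^ 2 - 1)
  else
    oddFactor l m (n / 2) * (t * jacobi (l - 1 / 2) (m + 1 / 2) (n / 2) (2 * t ^ 2 - 1))

/-- The coefficient `∫_{-1}^1 f(t) C̃_n(t) v_{l,m}(t) dt` of the generalized Gegenbauer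
expansion of `f`. -/
def coeff (l m : ℝ) (f : ℝ → ℂ) (n : ℕ) : ℂ :=
  ∫ t, f t * (orthoPoly l m n t : ℂ) ∂(weightMeasure l m)

/-- The norm of `f` in `L_p(v_{l,m})`, for real `p` (used for `f` in that space only). -/
def weightedNorm (l m p : ℝ) (f : ℝ → ℂ) : ℝ :=
  (eLpNorm f (ENNReal.ofReal p) (weightMeasure l m)).toReal

/-- The partial sum `∑_{n=0}^N φ(n) C̃_n(t)`. -/
def partialSum (l m : ℝ) (φ : ℕ → ℂ) (N : ℕ) (t : ℝ) : ℂ :=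
  ∑ n ∈ Finset.range (N + 1), φ n * (orthoPoly l m n t : ℂ)

end GenGegenbauer

end

open MeasureTheory Filter Topology

noncomputable section

namespace GenGegenbauer

/-! Put `w n = (n+1)^σ`. Two facts about the orthonormal system carry everything: Bessel's
inequality, and the uniform bound `|C̃_n| ≤ M (n+1)^σ` on `[-1,1]`. The operator taking `f` to the
sequence `f̂_n / w n`, on the integers with mass `w n ^ 2` at `n`, is then bounded from L² to ℓ² and
from L¹ to ℓ^∞. Since `(1/p' - 1/p) p' = 2 - p'`, the sum in (a) is exactly the `p'`-th power of the
norm of this sequence in the weighted ℓ^{p'}. So (a) is an interpolation between the two endpoints,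
done by hand in the manner of Marcinkiewicz: split `f` at a height depending on the level `x`, apply
the L¹ bound to the large part and Bessel to the small part, and integrate over `x`
(`IsBoundedOrthonormal.sqMeasure_coeff_gt_le`, `IsBoundedOrthonormal.tsum_sq_mul_coeff_rpow_le`).

Part (b) is dual to (a). Testing a finite sum `g` against `conj g * |g|^(q-2)` and using Hölder on
the coefficients gives the bound with the same constant (`IsBoundedOrthonormal.eLpNorm_sum_le`).
Applied to blocks of the series, it shows that the partial sums are Cauchy; completeness and
continuity of the coefficient functionals do the rest.

The uniform bound comes from Sonin-type energies. The substitution `s = t^2` turns the polynomials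
into Jacobi polynomials on `[0,1]`; their differential equation controls the derivative of a
quadratic energy, so the maximum is dominated by the endpoint values (`shiftedJacobi_even_sq_le`,
`mul_shiftedJacobi_odd_sq_le`). These are explicit Gamma quotients, and Euler's limit gives their
growth. The endpoint `s = 1` contributes the exponent `l` and `s = 0` contributes `m`, whence `σ =
max(l, m)`. Orthonormality follows from term-by-term Beta integrals summed by Chu–Vandermonde. -/

/-! ### Jacobi polynomials on the unit interval: endpoint values, leading coefficient, differential
equation. -/

open Polynomial in
/-- The Chu–Vandermonde identity. -/
theorem sum_choose_mul_ascPochhammer (n : ℕ) : ∀ b c : ℝ,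
    ∑ k ∈ Finset.range (n + 1), (-1) ^ k * (n.choose k : ℝ) * (ascPochhammer ℝ k).eval b
      * (ascPochhammer ℝ (n - k)).eval (c + k) = (ascPochhammer ℝ n).eval (c - b) := by
  induction n with
  | zero => intro b c; simp
  | succ n ih =>
    intro b c
    rw [Finset.sum_range_succ']
    -- Pascal's rule splits the sum. One part is `-b` times the identity for `(b+1, c+1)`; the
    -- other, together with the term `k = 0`, is `c + n` times the identity for `(b, c)`. Both have
    -- the same value by induction, so the factors add up to `c - b + n`.
    have h1 : ∀ k ∈ Finset.range (n + 1), (-1) ^ (k + 1) * ((n + 1).choose (k + 1) : ℝ)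
        * (ascPochhammer ℝ (k + 1)).eval b
        * (ascPochhammer ℝ (n + 1 - (k + 1))).eval (c + ((k + 1 : ℕ) : ℝ))
        = - b * ((-1) ^ k * (n.choose k : ℝ) * (ascPochhammer ℝ k).eval (b + 1)
            * (ascPochhammer ℝ (n - k)).eval (c + 1 + k))
          + (-1) ^ (k + 1) * (n.choose (k + 1) : ℝ) * (ascPochhammer ℝ (k + 1)).eval b
            * (ascPochhammer ℝ (n + 1 - (k + 1))).eval (c + ((k + 1 : ℕ) : ℝ)) := by
      intro k _
      rw [Nat.choose_succ_succ, ascPochhammer_succ_left]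
      simp only [eval_mul, eval_X, eval_comp, eval_add, eval_one, Nat.add_sub_add_right]
      push_cast
      rw [show c + 1 + (k : ℝ) = c + (k + 1) by ring]
      ring
    rw [Finset.sum_congr rfl h1, Finset.sum_add_distrib, ← Finset.mul_sum, ih, add_assoc]
    have h2 := Finset.sum_range_succ' (fun k => (-1) ^ k * (n.choose k : ℝ)
      * (ascPochhammer ℝ k).eval b * (ascPochhammer ℝ (n + 1 - k)).eval (c + (k : ℝ))) (n + 1)
    simp only [Nat.choose_zero_right] at h2 ⊢
    rw [← h2, Finset.sum_range_succ]
    have h3 : ∀ k ∈ Finset.range (n + 1), (-1) ^ k * (n.choose k : ℝ)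
        * (ascPochhammer ℝ k).eval b * (ascPochhammer ℝ (n + 1 - k)).eval (c + (k : ℝ))
        = (c + n) * ((-1) ^ k * (n.choose k : ℝ)
        * (ascPochhammer ℝ k).eval b * (ascPochhammer ℝ (n - k)).eval (c + (k : ℝ))) := by
      intro k hk
      have hk' : k ≤ n := Nat.lt_succ_iff.mp (Finset.mem_range.mp hk)
      rw [Nat.succ_sub hk', ascPochhammer_succ_eval, Nat.cast_sub hk']
      ring
    rw [Finset.sum_congr rfl h3, ← Finset.mul_sum, ih, ascPochhammer_succ_eval n (c - b),
      Nat.choose_succ_self, add_sub_add_right_eq_sub]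
    push_cast
    ring

/-- The coefficient of `((x-1)/2)^k` in the Jacobi polynomial `P_n^{(a,b)}(x)`. -/
def jacobiCoeff (a b : ℝ) (n k : ℕ) : ℝ :=
  (ascPochhammer ℝ k).eval ((n : ℝ) + a + b + 1) * (ascPochhammer ℝ (n - k)).eval (a + (k : ℝ) + 1)
    / ((k.factorial : ℝ) * ((n - k).factorial : ℝ))

open Polynomial in
/-- The shifted Jacobi polynomial `P_n^{(a,b)}(2s-1)`. -/
def shiftedJacobi (a b : ℝ) (n : ℕ) : ℝ[X] :=
  ∑ k ∈ Finset.range (n + 1), C (jacobiCoeff a b n k) * (X - 1) ^ k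

open Polynomial in
theorem shiftedJacobi_eval (a b : ℝ) (n : ℕ) (s : ℝ) :
    (shiftedJacobi a b n).eval s
      = ∑ k ∈ Finset.range (n + 1), jacobiCoeff a b n k * (s - 1) ^ k := by
  simp [shiftedJacobi, eval_finsetSum]

theorem jacobi_eq_shiftedJacobi_eval (a b : ℝ) (n : ℕ) (t : ℝ) :
    jacobi a b n (2 * t ^ 2 - 1) = (shiftedJacobi a b n).eval (t ^ 2) := by
  rw [shiftedJacobi_eval, jacobi]
  refine Finset.sum_congr rfl fun k _ => ?_
  rw [jacobiCoeff]
  congr 2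
  ring

theorem jacobiCoeff_eq (a b : ℝ) {n k : ℕ} (hk : k ≤ n) :
    jacobiCoeff a b n k = (n.choose k : ℝ) * (ascPochhammer ℝ k).eval ((n : ℝ) + a + b + 1)
      * (ascPochhammer ℝ (n - k)).eval (a + 1 + k) / n.factorial := by
  rw [jacobiCoeff, Nat.cast_choose ℝ hk, show a + (k : ℝ) + 1 = a + 1 + k by ring]
  have := n.factorial_ne_zero
  have := k.factorial_ne_zero
  have := (n - k).factorial_ne_zero
  field_simp

theorem shiftedJacobi_eval_one (a b : ℝ) (n : ℕ) :
    (shiftedJacobi a b n).eval 1 = (ascPochhammer ℝ n).eval (a + 1) / n.factorial := by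
  rw [shiftedJacobi_eval, Finset.sum_range_succ']
  simp [jacobiCoeff]

/-- At `s = 0` the powers of `s - 1` become signs and Chu–Vandermonde sums the series. Squaring
removes the sign `(-1)^n`, which the energy estimates never see. -/
theorem shiftedJacobi_eval_zero_sq (a b : ℝ) (n : ℕ) :
    (shiftedJacobi a b n).eval 0 ^ 2
      = ((ascPochhammer ℝ n).eval (b + 1) / n.factorial) ^ 2 := by
  have h : (shiftedJacobi a b n).eval 0
      = (ascPochhammer ℝ n).eval (a + 1 - (n + a + b + 1)) / n.factorial := by
    rw [shiftedJacobi_eval, ← sum_choose_mul_ascPochhammer, Finset.sum_div]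
    refine Finset.sum_congr rfl fun k hk => ?_
    rw [jacobiCoeff_eq a b (Nat.lt_succ_iff.mp (Finset.mem_range.mp hk)), zero_sub]
    ring
  have h2 : (ascPochhammer ℝ n).eval (a + 1 - (n + a + b + 1))
      = (-1) ^ n * (ascPochhammer ℝ n).eval (b + 1) := by
    rw [show a + 1 - (n + a + b + 1) = -(b + n) by ring, ascPochhammer_eval_neg_eq_descPochhammer,
      descPochhammer_eval_eq_ascPochhammer]
    congr 2
    ring
  rw [h, h2, div_pow, div_pow, mul_pow, ← pow_mul, mul_comm n 2, pow_mul]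
  simp

open Polynomial in
theorem shiftedJacobi_natDegree_le (a b : ℝ) (n : ℕ) : (shiftedJacobi a b n).natDegree ≤ n := by
  refine natDegree_sum_le_of_forall_le _ _ fun k hk => ?_
  refine (natDegree_C_mul_le _ _).trans ?_
  refine natDegree_pow_le.trans ?_
  have : (X - 1 : ℝ[X]).natDegree = 1 := by simpa using natDegree_X_sub_C (1 : ℝ)
  rw [this]
  have := Finset.mem_range.mp hk
  omega

open Polynomial in
theorem shiftedJacobi_coeff_self (a b : ℝ) (n : ℕ) :
    (shiftedJacobi a b n).coeff n = (ascPochhammer ℝ n).eval ((n : ℝ) + a + b + 1)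
      / n.factorial := by
  have hX : (X - 1 : ℝ[X]) = X - C 1 := by simp
  rw [shiftedJacobi, finsetSum_coeff, Finset.sum_range_succ, Finset.sum_eq_zero, zero_add,
    coeff_C_mul]
  · have h : ((X - 1 : ℝ[X]) ^ n).coeff n = 1 := by
      have := ((monic_X_sub_C (1 : ℝ)).pow n).coeff_natDegree
      rwa [natDegree_pow, natDegree_X_sub_C, mul_one, ← hX] at this
    rw [h]
    simp [jacobiCoeff]
  · intro k hk
    rw [coeff_C_mul, coeff_eq_zero_of_natDegree_lt, mul_zero]
    refine natDegree_pow_le.trans_lt ?_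
    rw [hX, natDegree_X_sub_C]
    have := Finset.mem_range.mp hk
    omega

/-- This is the hypergeometric differential equation read off on coefficients at the point `s = 1`.
-/
theorem jacobiCoeff_succ (a b : ℝ) {n k : ℕ} (hk : k < n) :
    (k + 1) * (k + 1 + a) * jacobiCoeff a b n (k + 1)
      = (n - k) * (n + k + a + b + 1) * jacobiCoeff a b n k := by
  obtain ⟨d, rfl⟩ := Nat.exists_eq_add_of_lt hk
  rw [jacobiCoeff, jacobiCoeff, ascPochhammer_succ_eval, show k + d + 1 - (k + 1) = d by omega,
    show k + d + 1 - k = d + 1 by omega, ascPochhammer_succ_left, Nat.factorial_succ,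
    Nat.factorial_succ]
  simp only [Polynomial.eval_mul, Polynomial.eval_X, Polynomial.eval_comp, Polynomial.eval_add,
    Polynomial.eval_one]
  have := k.factorial_ne_zero
  have := d.factorial_ne_zero
  push_cast
  rw [show a + ((k : ℝ) + 1) + 1 = a + k + 1 + 1 by ring]
  have h1 : (k : ℝ) + 1 ≠ 0 := by positivity
  have h2 : (d : ℝ) + 1 ≠ 0 := by positivity
  field_simp
  ring

-- In powers of `z = s - 1` the equation becomes a difference of two sums, one shifted by one index
-- against the other, which cancel by `jacobiCoeff_succ`.
open Polynomial in
theorem shiftedJacobi_ode (a b : ℝ) (n : ℕ) (s : ℝ) :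
    s * (1 - s) * (derivative (derivative (shiftedJacobi a b n))).eval s
      + (b + 1 - (a + b + 2) * s) * (derivative (shiftedJacobi a b n)).eval s
      + n * (n + a + b + 1) * (shiftedJacobi a b n).eval s = 0 := by
  set c := jacobiCoeff a b n
  set z := s - 1 with hz
  have hs : s = z + 1 := by rw [hz]; ring
  have h0 : (shiftedJacobi a b n).eval s = ∑ k ∈ Finset.range (n + 1), c k * z ^ k :=
    shiftedJacobi_eval a b n s
  have h1 : (derivative (shiftedJacobi a b n)).eval s
      = ∑ k ∈ Finset.range (n + 1), c k * (k * z ^ (k - 1)) := by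
    simp only [shiftedJacobi, derivative_sum, eval_finsetSum]
    refine Finset.sum_congr rfl fun k _ => ?_
    have hX : (X - 1 : ℝ[X]) = X - C 1 := by simp
    rw [hX, derivative_C_mul, derivative_X_sub_C_pow]
    simp [c, hz]
  have h2 : (derivative (derivative (shiftedJacobi a b n))).eval s
      = ∑ k ∈ Finset.range (n + 1), c k * (k * (((k - 1 : ℕ) : ℝ) * z ^ (k - 1 - 1))) := by
    simp only [shiftedJacobi, derivative_sum, eval_finsetSum]
    refine Finset.sum_congr rfl fun k _ => ?_
    have hX : (X - 1 : ℝ[X]) = X - C 1 := by simp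
    rw [hX, derivative_C_mul, derivative_X_sub_C_pow, derivative_C_mul, derivative_C_mul,
      derivative_X_sub_C_pow]
    simp [c, hz]
  rw [h0, h1, h2, Finset.mul_sum, Finset.mul_sum, Finset.mul_sum, ← Finset.sum_add_distrib,
    ← Finset.sum_add_distrib]
  have h3 : ∀ k ∈ Finset.range (n + 1),
      s * (1 - s) * (c k * (k * (((k - 1 : ℕ) : ℝ) * z ^ (k - 1 - 1))))
      + (b + 1 - (a + b + 2) * s) * (c k * (k * z ^ (k - 1)))
      + n * (n + a + b + 1) * (c k * z ^ k)
      = (n - k) * (n + k + a + b + 1) * c k * z ^ k - k * (k + a) * c k * z ^ (k - 1) := by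
    intro k _
    rw [hs]
    -- The first two indices are separate because the exponents `k - 1` and `k - 1 - 1` are
    -- truncated there.
    rcases k with _ | _ | k
    · simp
    · simp; ring
    · simp only [Nat.add_sub_cancel]
      push_cast
      ring
  rw [Finset.sum_congr rfl h3, Finset.sum_sub_distrib, Finset.sum_range_succ,
    Finset.sum_range_succ' (fun k : ℕ => (k : ℝ) * (k + a) * c k * z ^ (k - 1))]
  simp only [sub_self, zero_mul, Nat.cast_zero, add_zero, Nat.add_sub_cancel]
  rw [sub_eq_zero]
  refine Finset.sum_congr rfl fun k hk => ?_
  rw [← jacobiCoeff_succ a b (Finset.mem_range.mp hk)]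
  push_cast
  ring

/-! ### Energy estimates: the maximum is controlled by the endpoint values. -/

section Energy

/-- A one-sided Grönwall estimate on the left half of the unit interval. -/
theorem le_exp_mul_of_deriv_le {G G' : ℝ → ℝ} {L : ℝ} (hG : ∀ s, HasDerivAt G (G' s) s)
    (h0 : ∀ s, 0 ≤ s → s ≤ 1 → 0 ≤ G s) (hL : 0 ≤ L)
    (h : ∀ s, 0 ≤ s → s ≤ 1 → (1 - s) * G' s ≤ 2 * L * G s) {s : ℝ} (hs0 : 0 ≤ s)
    (hs : s ≤ 1 / 2) : G s ≤ Real.exp (2 * L) * G 0 := by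
  have hd : ∀ s, HasDerivAt (fun s => G s * Real.exp (-(4 * L) * s))
      (G' s * Real.exp (-(4 * L) * s) + G s * (Real.exp (-(4 * L) * s) * (-(4 * L) * 1))) s :=
    fun s => (hG s).mul (((hasDerivAt_id s).const_mul _).exp)
  have hanti : AntitoneOn (fun s => G s * Real.exp (-(4 * L) * s)) (Set.Icc 0 (1 / 2)) := by
    refine antitoneOn_of_deriv_nonpos (convex_Icc _ _)
      (fun x _ => (hd x).continuousAt.continuousWithinAt)
      (fun x _ => (hd x).differentiableAt.differentiableWithinAt) fun x hx => ?_
    rw [interior_Icc] at hx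
    rw [(hd x).deriv]
    have hx1 : x ≤ 1 := by linarith [hx.2]
    have e := Real.exp_pos (-(4 * L) * x)
    -- On this half `1 - x ≥ 1/2`, so dividing by `1 - x` costs at most a factor 2 when `G' x > 0`.
    -- Over an interval of length `1/2` the rate `4 * L` yields the exponent `2 * L`.
    have : G' x ≤ 4 * L * G x := by
      have h1 := h x hx.1.le hx1
      have h2 := mul_nonneg hL (h0 x hx.1.le hx1)
      rcases le_or_gt (G' x) 0 with h3 | h3
      · linarith
      · nlinarith [hx.2]
    nlinarith
  have h1 := hanti (by constructor <;> norm_num) ⟨hs0, hs⟩ hs0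
  simp only [mul_zero, Real.exp_zero, mul_one] at h1
  have h2 : G s = G s * Real.exp (-(4 * L) * s) * Real.exp (4 * L * s) := by
    rw [mul_assoc, ← Real.exp_add]; simp
  have hG0 := h0 0 le_rfl zero_le_one
  calc G s = G s * Real.exp (-(4 * L) * s) * Real.exp (4 * L * s) := h2
    _ ≤ G 0 * Real.exp (2 * L) :=
      mul_le_mul h1 (Real.exp_le_exp.2 (by nlinarith)) (Real.exp_pos _).le hG0
    _ = _ := mul_comm _ _

/-- For negative `l` the energy is decreasing, so `G 0` alone suffices. Otherwise Grönwall runs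
inwards from each endpoint to the midpoint, the right half being reflected by `s ↦ 1 - s`; this
avoids the degenerate factor at the opposite end. -/
theorem le_exp_mul_endpoints {G G' : ℝ → ℝ} {l m : ℝ} (hG : ∀ s, HasDerivAt G (G' s) s)
    (h0 : ∀ s, 0 ≤ s → s ≤ 1 → 0 ≤ G s) (hm : 0 ≤ m)
    (h1 : 0 ≤ l → ∀ s, 0 ≤ s → s ≤ 1 → (1 - s) * G' s ≤ 2 * l * G s)
    (h2 : 0 ≤ l → ∀ s, 0 ≤ s → s ≤ 1 → -(2 * m * G s) ≤ s * G' s)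
    (h3 : l < 0 → ∀ s, 0 ≤ s → s ≤ 1 → G' s ≤ 0)
    {s : ℝ} (hs0 : 0 ≤ s) (hs : s ≤ 1) :
    G s ≤ Real.exp (2 * |l| + 2 * m) * (G 0 + G 1) := by
  have g0 := h0 0 le_rfl zero_le_one
  have g1 := h0 1 zero_le_one le_rfl
  rcases lt_or_ge l 0 with hl | hl
  · have hanti : AntitoneOn G (Set.Icc 0 1) := by
      refine antitoneOn_of_deriv_nonpos (convex_Icc _ _)
        (fun x _ => (hG x).continuousAt.continuousWithinAt)
        (fun x _ => (hG x).differentiableAt.differentiableWithinAt) fun x hx => ?_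
      rw [interior_Icc] at hx
      rw [(hG x).deriv]
      exact h3 hl x hx.1.le hx.2.le
    have h4 : G s ≤ G 0 := hanti (by simp) ⟨hs0, hs⟩ hs0
    have h5 : 1 ≤ Real.exp (2 * |l| + 2 * m) := Real.one_le_exp (by positivity)
    nlinarith
  · rw [abs_of_nonneg hl]
    rcases le_or_gt s (1 / 2) with h | h
    · have h4 := le_exp_mul_of_deriv_le hG h0 hl (h1 hl) hs0 h
      have h5 : Real.exp (2 * l) ≤ Real.exp (2 * l + 2 * m) := Real.exp_le_exp.2 (by linarith)
      have h6 := Real.exp_pos (2 * l + 2 * m)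
      nlinarith
    · have h4 := le_exp_mul_of_deriv_le (G := fun s => G (1 - s)) (G' := fun s => -G' (1 - s))
        (L := m) (s := 1 - s) (fun x => by
          simpa [Function.comp_def] using (hG (1 - x)).comp x ((hasDerivAt_id x).const_sub 1))
        (fun x hx hx1 => h0 _ (by linarith) (by linarith)) hm
        (fun x hx hx1 => by
          have := h2 hl (1 - x) (by linarith) (by linarith)
          linarith) (by linarith) (by linarith)
      simp only [sub_sub_cancel, sub_zero] at h4
      have h5 : Real.exp (2 * m) ≤ Real.exp (2 * l + 2 * m) := Real.exp_le_exp.2 (by linarith)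
      have h6 := Real.exp_pos (2 * l + 2 * m)
      nlinarith

-- The Sonin energy is `k Q² + s(1-s) Q'²`. Its derivative loses all terms in `Q''` and `Q Q'`
-- through the differential equation and equals `Q'² (2ls - 2m(1-s))`. At both endpoints only `k Q²`
-- remains, and `k` cancels.
open Polynomial in
theorem shiftedJacobi_even_sq_le {l m : ℝ} (hl : -1 / 2 < l) (hm : 0 ≤ m) (n : ℕ) {s : ℝ}
    (hs0 : 0 ≤ s) (hs : s ≤ 1) :
    (shiftedJacobi (l - 1 / 2) (m - 1 / 2) n).eval s ^ 2
      ≤ Real.exp (2 * |l| + 2 * m) * ((shiftedJacobi (l - 1 / 2) (m - 1 / 2) n).eval 0 ^ 2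
        + (shiftedJacobi (l - 1 / 2) (m - 1 / 2) n).eval 1 ^ 2) := by
  -- For `n = 0` the factor `k` vanishes and cannot be cancelled, but the polynomial is constant.
  rcases n.eq_zero_or_pos with rfl | hn
  · have h5 : 1 ≤ Real.exp (2 * |l| + 2 * m) := Real.one_le_exp (by positivity)
    simp [shiftedJacobi, jacobiCoeff]
    linarith
  set Q := shiftedJacobi (l - 1 / 2) (m - 1 / 2) n with hQ
  have hn1 : (1 : ℝ) ≤ n := by exact_mod_cast hn
  have hk : 0 < n * (n + l + m) := by apply mul_pos <;> linarith
  set k := n * (n + l + m) with hkdef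
  have ode : ∀ s, s * (1 - s) * (derivative (derivative Q)).eval s
      = - (m + 1 / 2 - (l + m + 1) * s) * (derivative Q).eval s - k * Q.eval s := by
    intro s
    have := shiftedJacobi_ode (l - 1 / 2) (m - 1 / 2) n s
    rw [← hQ] at this
    rw [hkdef]
    linarith
  have h := le_exp_mul_endpoints (l := l) (m := m)
    (G := fun s => k * Q.eval s ^ 2 + s * (1 - s) * (derivative Q).eval s ^ 2)
    (G' := fun s => (derivative Q).eval s ^ 2 * (2 * l * s - 2 * m * (1 - s)))
    (fun s => by
      convert! (((Q.hasDerivAt s).pow 2).const_mul k).add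
        (((hasDerivAt_id s).mul ((hasDerivAt_id s).const_sub 1)).mul
          (((derivative Q).hasDerivAt s).pow 2)) using 1
      simp only [Pi.mul_apply, Pi.pow_apply, id, Nat.add_one_sub_one, pow_one, Nat.cast_ofNat]
      linear_combination (2 * (derivative Q).eval s) * -ode s)
    (fun s h0 h1 => by have := sub_nonneg.2 h1; positivity) hm
    (fun h s h0 h1 => by
      have h2 := sub_nonneg.2 h1
      have h3 : 0 ≤ m * ((1 - s) ^ 2 * (derivative Q).eval s ^ 2) := by positivity
      have h4 : 0 ≤ l * (k * Q.eval s ^ 2) := by positivity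
      nlinarith)
    (fun h s h0 h1 => by
      have h2 := sub_nonneg.2 h1
      have h3 : 0 ≤ l * (s ^ 2 * (derivative Q).eval s ^ 2) := by positivity
      have h4 : 0 ≤ m * (k * Q.eval s ^ 2) := by positivity
      nlinarith)
    (fun h s h0 h1 => by
      have h2 := sub_nonneg.2 h1
      have h3 : 0 ≤ m * ((1 - s) * (derivative Q).eval s ^ 2) := by positivity
      have h4 : 0 ≤ -l * (s * (derivative Q).eval s ^ 2) :=
        mul_nonneg (by linarith) (by positivity)
      nlinarith) hs0 hs
  simp only [zero_mul, add_zero, sub_self, mul_zero] at h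
  have h2 : 0 ≤ s * (1 - s) * (derivative Q).eval s ^ 2 := by
    have := sub_nonneg.2 hs; positivity
  refine le_of_mul_le_mul_left ?_ hk
  nlinarith

-- For the odd function `t Q(t²)` the ordinary derivative is replaced by the Dunkl derivative, which
-- adds `2m Q` and gives `W = (1+2m) Q + 2s Q'`. The energy `k s Q² + (1-s) W²` then has derivative
-- `2l W² - 2mk Q²`. At `s = 0` it reduces to `W(0)²`, which carries no factor `k`; this gain of
-- order `n²` offsets the larger size of `Q(0)`.
open Polynomial in
theorem mul_shiftedJacobi_odd_sq_le {l m : ℝ} (hl : -1 / 2 < l) (hm : 0 ≤ m) (n : ℕ) {s : ℝ}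
    (hs0 : 0 ≤ s) (hs : s ≤ 1) :
    (2 * n + 1 + 2 * l) * (2 * n + 1 + 2 * m)
        * (s * (shiftedJacobi (l - 1 / 2) (m + 1 / 2) n).eval s ^ 2)
      ≤ Real.exp (2 * |l| + 2 * m)
        * ((1 + 2 * m) ^ 2 * (shiftedJacobi (l - 1 / 2) (m + 1 / 2) n).eval 0 ^ 2
        + (2 * n + 1 + 2 * l) * (2 * n + 1 + 2 * m)
          * (shiftedJacobi (l - 1 / 2) (m + 1 / 2) n).eval 1 ^ 2) := by
  set Q := shiftedJacobi (l - 1 / 2) (m + 1 / 2) n with hQ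
  have hn1 : (0 : ℝ) ≤ n := n.cast_nonneg
  have hk : 0 < (2 * n + 1 + 2 * l) * (2 * n + 1 + 2 * m) := by apply mul_pos <;> linarith
  set k := (2 * n + 1 + 2 * l) * (2 * n + 1 + 2 * m) with hkdef
  set W : ℝ → ℝ := fun s => (1 + 2 * m) * Q.eval s + 2 * s * (derivative Q).eval s with hW
  have ode : ∀ s, s * (1 - s) * (derivative (derivative Q)).eval s
      = - (m + 3 / 2 - (l + m + 2) * s) * (derivative Q).eval s
        - n * (n + l + m + 1) * Q.eval s := by
    intro s
    have := shiftedJacobi_ode (l - 1 / 2) (m + 1 / 2) n s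
    rw [← hQ] at this
    linarith
  have hWd : ∀ s, HasDerivAt W ((3 + 2 * m) * (derivative Q).eval s
      + 2 * s * (derivative (derivative Q)).eval s) s := by
    intro s
    convert! ((Q.hasDerivAt s).const_mul (1 + 2 * m)).add
      (((hasDerivAt_id s).const_mul 2).mul ((derivative Q).hasDerivAt s)) using 1
    simp only [id]
    ring
  have h := le_exp_mul_endpoints (l := l) (m := m)
    (G := fun s => k * (s * Q.eval s ^ 2) + (1 - s) * W s ^ 2)
    (G' := fun s => 2 * l * W s ^ 2 - 2 * m * k * Q.eval s ^ 2)
    (fun s => by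
      convert! (((hasDerivAt_id s).mul ((Q.hasDerivAt s).pow 2)).const_mul k).add
        (((hasDerivAt_id s).const_sub 1).mul ((hWd s).pow 2)) using 1
      simp only [Pi.pow_apply, id, Nat.add_one_sub_one, pow_one, Nat.cast_ofNat]
      simp only [hW, hkdef]
      linear_combination (4 * ((1 + 2 * m) * Q.eval s + 2 * s * (derivative Q).eval s)) * -ode s)
    (fun s h0 h1 => by have := sub_nonneg.2 h1; positivity) hm
    (fun h s h0 h1 => by
      have h2 := sub_nonneg.2 h1
      have h3 : 0 ≤ (1 - s) * (m * (k * Q.eval s ^ 2)) := by positivity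
      have h4 : 0 ≤ l * (k * (s * Q.eval s ^ 2)) := by positivity
      nlinarith)
    (fun h s h0 h1 => by
      have h2 := sub_nonneg.2 h1
      have h3 : 0 ≤ s * (l * W s ^ 2) := by positivity
      have h4 : 0 ≤ m * ((1 - s) * W s ^ 2) := by positivity
      nlinarith)
    (fun h s h0 h1 => by
      have h3 : 0 ≤ m * (k * Q.eval s ^ 2) := by positivity
      have h4 : 0 ≤ -l * W s ^ 2 := mul_nonneg (by linarith) (by positivity)
      nlinarith) hs0 hs
  have hW0 : W 0 = (1 + 2 * m) * Q.eval 0 := by simp [hW]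
  simp only [zero_mul, sub_self, mul_zero, sub_zero, one_mul, hW0, add_zero, zero_add,
    mul_pow] at h
  have h2 : 0 ≤ (1 - s) * W s ^ 2 := by
    have := sub_nonneg.2 hs; positivity
  linarith

end Energy

/-! ### Gamma asymptotics and the uniform growth bound. -/

section Growth

theorem ascPochhammer_eval_eq_Gamma_div {a : ℝ} (ha : 0 < a) (n : ℕ) :
    (ascPochhammer ℝ n).eval a = Real.Gamma (n + a) / Real.Gamma a := by
  have h0 := (Real.Gamma_pos_of_pos ha).ne'
  induction n with
  | zero => simp [h0]
  | succ n ih =>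
    have : (n : ℝ) + a ≠ 0 := by positivity
    rw [ascPochhammer_succ_eval, ih, Nat.cast_succ, add_right_comm, Real.Gamma_add_one this]
    ring

/-- A form of Euler's limit `GammaSeq a n → Γ(a)`, corrected by elementary factors tending to 1. -/
theorem tendsto_Gamma_div {a : ℝ} (ha : 0 < a) :
    Tendsto (fun n : ℕ => Real.Gamma (n + a) / (n.factorial * ((n : ℝ) + 1) ^ (a - 1)))
      atTop (𝓝 1) := by
  -- The denominator of `GammaSeq a n` has `n + 1` factors, so it is `Γ(n+1+a)/Γ(a)`; hence the
  -- shift.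
  rw [← tendsto_add_atTop_iff_nat 1]
  have hG := Real.Gamma_pos_of_pos ha
  have h1 : Tendsto (fun n : ℕ => Real.Gamma a / Real.GammaSeq a n) atTop (𝓝 1) := by
    have := (tendsto_const_nhds (x := Real.Gamma a)).div (Real.GammaSeq_tendsto_Gamma a) hG.ne'
    rwa [div_self hG.ne'] at this
  have h2 : Tendsto (fun n : ℕ => (n : ℝ) / ((n : ℝ) + 1)) atTop (𝓝 1) :=
    tendsto_natCast_div_add_atTop 1
  have h3 : Tendsto (fun n : ℕ => (n : ℝ) / ((n : ℝ) + 2)) atTop (𝓝 1) :=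
    tendsto_natCast_div_add_atTop 2
  have h4 : Tendsto (fun n : ℕ => ((n : ℝ) / ((n : ℝ) + 2)) ^ (a - 1)) atTop (𝓝 1) := by
    simpa using h3.rpow_const (p := a - 1) (Or.inl one_ne_zero)
  have h5 := (h1.mul h2).mul h4
  simp only [one_mul] at h5
  refine h5.congr' ?_
  filter_upwards [eventually_gt_atTop 0] with n hn
  have hn' : (0 : ℝ) < n := by exact_mod_cast hn
  have hprod : ∏ j ∈ Finset.range (n + 1), (a + j) = Real.Gamma (n + 1 + a) / Real.Gamma a := by
    have := ascPochhammer_eval_eq_Gamma_div ha (n + 1)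
    push_cast at this
    rw [← this]
    induction n + 1 with
    | zero => simp
    | succ k ih => rw [Finset.prod_range_succ, ih, ascPochhammer_succ_eval]
  have hf : (n.factorial : ℝ) ≠ 0 := by exact_mod_cast n.factorial_ne_zero
  have hG2 : 0 < Real.Gamma (n + 1 + a) := Real.Gamma_pos_of_pos (by positivity)
  have hp : 0 < (n : ℝ) ^ a := Real.rpow_pos_of_pos hn' _
  have hp2 : 0 < ((n : ℝ) + 2) ^ (a - 1) := Real.rpow_pos_of_pos (by positivity) _
  rw [Real.GammaSeq, hprod, Real.div_rpow hn'.le (by positivity), Real.rpow_sub_one hn'.ne',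
    Nat.factorial_succ]
  push_cast
  rw [show (n : ℝ) + 1 + 1 = n + 2 by ring]
  field_simp

/-- A sequence with nonzero limit is bounded, and so is the sequence of its inverses. -/
theorem exists_Gamma_bounds {a : ℝ} (ha : 0 < a) : ∃ C : ℝ, 0 < C ∧ ∀ n : ℕ,
    Real.Gamma (n + a) ≤ C * (n.factorial * ((n : ℝ) + 1) ^ (a - 1)) ∧
    n.factorial * ((n : ℝ) + 1) ^ (a - 1) ≤ C * Real.Gamma (n + a) := by
  have h1 := tendsto_Gamma_div ha
  have h2 := h1.inv₀ one_ne_zero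
  obtain ⟨A, hA⟩ := h1.bddAbove_range
  obtain ⟨B, hB⟩ := h2.bddAbove_range
  refine ⟨max 1 (max A B), by positivity, fun n => ?_⟩
  have hG : 0 < Real.Gamma (n + a) := Real.Gamma_pos_of_pos (by positivity)
  have hp : 0 < n.factorial * ((n : ℝ) + 1) ^ (a - 1) := by positivity
  have hA' := hA (Set.mem_range_self n)
  have hB' := hB (Set.mem_range_self n)
  simp only [inv_div] at hA' hB'
  constructor
  · rw [← div_le_iff₀ hp]
    exact hA'.trans (le_max_of_le_right (le_max_left _ _))
  · rw [← div_le_iff₀ hG]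
    exact hB'.trans (le_max_of_le_right (le_max_right _ _))

theorem exists_ascPochhammer_div_factorial_sq_le {a : ℝ} (ha : 0 < a) :
    ∃ C : ℝ, 0 < C ∧ ∀ n : ℕ, ((ascPochhammer ℝ n).eval a / n.factorial) ^ 2
      ≤ C * ((n : ℝ) + 1) ^ (2 * (a - 1)) := by
  obtain ⟨C, hC, h⟩ := exists_Gamma_bounds ha
  have hG := Real.Gamma_pos_of_pos ha
  refine ⟨(C / Real.Gamma a) ^ 2, by positivity, fun n => ?_⟩
  have hf : (0 : ℝ) < n.factorial := by exact_mod_cast n.factorial_pos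
  have hn : (0 : ℝ) < (n : ℝ) + 1 := by positivity
  have h0 := (ascPochhammer_pos n a ha).le
  rw [mul_comm 2, Real.rpow_mul hn.le, Real.rpow_two, ← mul_pow]
  refine pow_le_pow_left₀ (by positivity) ?_ 2
  rw [ascPochhammer_eval_eq_Gamma_div ha, div_div, div_le_iff₀ (by positivity)]
  refine (h n).1.trans (le_of_eq ?_)
  field_simp

/-- The common growth estimate behind `evenFactor` and `oddFactor`. -/
theorem exists_Gamma_quotient_le {a b c : ℝ} (ha : 0 < a) (hb : 0 < b) (hc : 0 < c)
    (h : a = b + c) : ∃ C : ℝ, 0 < C ∧ ∀ n : ℕ,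
      n.factorial * Real.Gamma (n + a) / (Real.Gamma (n + b) * Real.Gamma (n + c))
        ≤ C * ((n : ℝ) + 1) := by
  obtain ⟨A, hA, h1⟩ := exists_Gamma_bounds ha
  obtain ⟨B, hB, h2⟩ := exists_Gamma_bounds hb
  obtain ⟨D, hD, h3⟩ := exists_Gamma_bounds hc
  refine ⟨A * B * D, by positivity, fun n => ?_⟩
  have hn : (0 : ℝ) < (n : ℝ) + 1 := by positivity
  have hf : (0 : ℝ) < n.factorial := by exact_mod_cast n.factorial_pos
  have hGb : 0 < Real.Gamma (n + b) := Real.Gamma_pos_of_pos (by positivity)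
  have hGc : 0 < Real.Gamma (n + c) := Real.Gamma_pos_of_pos (by positivity)
  rw [div_le_iff₀ (by positivity)]
  have e : ((n : ℝ) + 1) ^ (a - 1) = ((n : ℝ) + 1) * (((n : ℝ) + 1) ^ (b - 1)
      * ((n : ℝ) + 1) ^ (c - 1)) := by
    rw [← Real.rpow_add hn, mul_comm, ← Real.rpow_add_one hn.ne']
    congr 1
    linarith
  calc n.factorial * Real.Gamma (n + a)
      ≤ n.factorial * (A * (n.factorial * ((n : ℝ) + 1) ^ (a - 1))) := by gcongr; exact (h1 n).1
    _ = A * ((n : ℝ) + 1) * ((n.factorial * ((n : ℝ) + 1) ^ (b - 1))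
          * (n.factorial * ((n : ℝ) + 1) ^ (c - 1))) := by rw [e]; ring
    _ ≤ A * ((n : ℝ) + 1) * ((B * Real.Gamma (n + b)) * (D * Real.Gamma (n + c))) := by
        exact mul_le_mul_of_nonneg_left (mul_le_mul (h2 n).2 (h3 n).2 (by positivity)
          (by positivity)) (by positivity)
    _ = _ := by ring

theorem exists_evenFactor_sq_le {l m : ℝ} (hl : -1 / 2 < l) (hm : 0 ≤ m) :
    ∃ C : ℝ, 0 < C ∧ ∀ n : ℕ, evenFactor l m n ^ 2 ≤ C * ((n : ℝ) + 1) := by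
  obtain ⟨C, hC, h⟩ := exists_Gamma_quotient_le (a := l + m + 1) (b := l + 1 / 2) (c := m + 1 / 2)
    (by linarith) (by linarith) (by linarith) (by ring)
  -- The factor 4 absorbs `2N + l + m ≤ 4(N + l + m)` for `N ≥ 1`; a factor 2 would fail when `l + m
  -- < 0`. Comparing with `Γ(n+l+m+1)` keeps the argument positive even at `n = 0`.
  refine ⟨4 * C, by positivity, fun n => ?_⟩
  refine le_trans ?_ ((mul_le_mul_of_nonneg_left (h n) (by norm_num : (0 : ℝ) ≤ 4)).trans_eq
    (by ring))
  have hG1 : 0 < Real.Gamma (n + (l + 1 / 2)) :=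
    Real.Gamma_pos_of_pos (by have := n.cast_nonneg (α := ℝ); linarith)
  have hG2 : 0 < Real.Gamma (n + (m + 1 / 2)) :=
    Real.Gamma_pos_of_pos (by have := n.cast_nonneg (α := ℝ); linarith)
  rcases n with _ | n
  · have hG3 : 0 < Real.Gamma (l + m + 1) := Real.Gamma_pos_of_pos (by linarith)
    simp only [CharP.cast_eq_zero, zero_add] at hG1 hG2
    have h0 : 0 ≤ Real.Gamma (l + m + 1) / (Real.Gamma (l + 1 / 2) * Real.Gamma (m + 1 / 2)) := by
      positivity
    rw [evenFactor, Real.sq_sqrt h0]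
    simp only [CharP.cast_eq_zero, zero_add, Nat.factorial_zero, Nat.cast_one, one_mul]
    linarith
  · rw [evenFactor]
    set N : ℝ := ((n + 1 : ℕ) : ℝ) with hN
    have hN1 : 1 ≤ N := by rw [hN]; push_cast; linarith [n.cast_nonneg (α := ℝ)]
    rw [Real.Gamma_nat_eq_factorial, show N + l + 1 / 2 = N + (l + 1 / 2) by ring,
      show N + m + 1 / 2 = N + (m + 1 / 2) by ring, show N + (l + m + 1) = N + l + m + 1 by ring,
      Real.Gamma_add_one (s := N + l + m) (by linarith)]
    have hG3 : 0 < Real.Gamma (N + l + m) := Real.Gamma_pos_of_pos (by linarith)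
    have hf : (0 : ℝ) < ((n + 1).factorial : ℝ) := by exact_mod_cast (n + 1).factorial_pos
    rw [Real.sq_sqrt (div_nonneg (mul_nonneg (mul_nonneg (by linarith) hf.le) hG3.le)
      (by positivity)), ← mul_div_assoc]
    gcongr ?_ / _
    rw [show 4 * (((n + 1).factorial : ℝ) * ((N + l + m) * Real.Gamma (N + l + m)))
      = 4 * (N + l + m) * (n + 1).factorial * Real.Gamma (N + l + m) by ring]
    gcongr
    linarith

theorem exists_oddFactor_sq_le {l m : ℝ} (hl : -1 / 2 < l) (hm : 0 ≤ m) :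
    ∃ C : ℝ, 0 < C ∧ ∀ n : ℕ, oddFactor l m n ^ 2 ≤ C * ((n : ℝ) + 1) := by
  obtain ⟨C, hC, h⟩ := exists_Gamma_quotient_le (a := l + m + 2) (b := l + 1 / 2) (c := m + 3 / 2)
    (by linarith) (by linarith) (by linarith) (by ring)
  refine ⟨2 * C, by positivity, fun n => ?_⟩
  refine le_trans ?_ ((mul_le_mul_of_nonneg_left (h n) (by norm_num : (0 : ℝ) ≤ 2)).trans_eq
    (by ring))
  have hn := n.cast_nonneg (α := ℝ)
  have hG1 : 0 < Real.Gamma (n + (l + 1 / 2)) := Real.Gamma_pos_of_pos (by linarith)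
  have hG2 : 0 < Real.Gamma (n + (m + 3 / 2)) := Real.Gamma_pos_of_pos (by linarith)
  rw [oddFactor, Real.Gamma_nat_eq_factorial, show (n : ℝ) + l + 1 / 2 = n + (l + 1 / 2) by ring,
      show (n : ℝ) + m + 3 / 2 = n + (m + 3 / 2) by ring,
      show (n : ℝ) + (l + m + 2) = n + l + m + 1 + 1 by ring,
      Real.Gamma_add_one (s := n + l + m + 1) (by linarith)]
  have hG3 : 0 < Real.Gamma (n + l + m + 1) := Real.Gamma_pos_of_pos (by linarith)
  have hf : (0 : ℝ) < (n.factorial : ℝ) := by exact_mod_cast n.factorial_pos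
  rw [Real.sq_sqrt (div_nonneg (mul_nonneg (mul_nonneg (by linarith) hf.le) hG3.le)
      (by positivity)), ← mul_div_assoc]
  gcongr ?_ / _
  rw [show 2 * ((n.factorial : ℝ) * ((n + l + m + 1) * Real.Gamma (n + l + m + 1)))
      = 2 * (n + l + m + 1) * n.factorial * Real.Gamma (n + l + m + 1) by ring]
  gcongr
  linarith

/-- The squared normalization is of order at most `n`, the squared endpoint values at most
`n^(2m-1)` and `n^(2l-1)`; the products are at most `n^(2σ)`. -/
theorem exists_even_sq_le {l m : ℝ} (hl : -1 / 2 < l) (hm : 0 ≤ m) :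
    ∃ C : ℝ, 0 < C ∧ ∀ (n : ℕ) (s : ℝ), 0 ≤ s → s ≤ 1 →
      (evenFactor l m n * (shiftedJacobi (l - 1 / 2) (m - 1 / 2) n).eval s) ^ 2
        ≤ C * ((n : ℝ) + 1) ^ (2 * max l m) := by
  obtain ⟨A, hA, h1⟩ := exists_evenFactor_sq_le hl hm
  obtain ⟨B, hB, h2⟩ := exists_ascPochhammer_div_factorial_sq_le (a := l - 1 / 2 + 1) (by linarith)
  obtain ⟨D, hD, h3⟩ := exists_ascPochhammer_div_factorial_sq_le (a := m - 1 / 2 + 1) (by linarith)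
  refine ⟨A * (Real.exp (2 * |l| + 2 * m) * (D + B)), by positivity, fun n s hs0 hs => ?_⟩
  have hn : (1 : ℝ) ≤ (n : ℝ) + 1 := by linarith [n.cast_nonneg (α := ℝ)]
  have hn0 : (0 : ℝ) < (n : ℝ) + 1 := by linarith
  have e : ∀ x : ℝ, x ≤ max l m → ((n : ℝ) + 1) * ((n : ℝ) + 1) ^ (2 * (x - 1 / 2 + 1 - 1))
      ≤ ((n : ℝ) + 1) ^ (2 * max l m) := by
    intro x hx
    rw [mul_comm, ← Real.rpow_add_one hn0.ne']
    exact Real.rpow_le_rpow_of_exponent_le hn (by linarith)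
  have k2 := h2 n
  have k3 := h3 n
  rw [← shiftedJacobi_eval_one] at k2
  rw [← shiftedJacobi_eval_zero_sq (l - 1 / 2)] at k3
  rw [mul_pow]
  calc _ ≤ (A * ((n : ℝ) + 1)) * (Real.exp (2 * |l| + 2 * m)
        * (D * ((n : ℝ) + 1) ^ (2 * (m - 1 / 2 + 1 - 1))
          + B * ((n : ℝ) + 1) ^ (2 * (l - 1 / 2 + 1 - 1)))) := by
        refine mul_le_mul (h1 n) ((shiftedJacobi_even_sq_le hl hm n hs0 hs).trans ?_)
          (sq_nonneg _) (by positivity)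
        gcongr
    _ = A * (Real.exp (2 * |l| + 2 * m)
        * (D * (((n : ℝ) + 1) * ((n : ℝ) + 1) ^ (2 * (m - 1 / 2 + 1 - 1)))
          + B * (((n : ℝ) + 1) * ((n : ℝ) + 1) ^ (2 * (l - 1 / 2 + 1 - 1))))) := by ring
    _ ≤ A * (Real.exp (2 * |l| + 2 * m) * (D * ((n : ℝ) + 1) ^ (2 * max l m)
          + B * ((n : ℝ) + 1) ^ (2 * max l m))) := by
        gcongr
        · exact e m (le_max_right _ _)
        · exact e l (le_max_left _ _)
    _ = _ := by ring

theorem exists_odd_sq_le {l m : ℝ} (hl : -1 / 2 < l) (hm : 0 ≤ m) :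
    ∃ C : ℝ, 0 < C ∧ ∀ (n : ℕ) (s : ℝ), 0 ≤ s → s ≤ 1 →
      oddFactor l m n ^ 2 * (s * (shiftedJacobi (l - 1 / 2) (m + 1 / 2) n).eval s ^ 2)
        ≤ C * ((n : ℝ) + 1) ^ (2 * max l m) := by
  obtain ⟨A, hA, h1⟩ := exists_oddFactor_sq_le hl hm
  obtain ⟨B, hB, h2⟩ := exists_ascPochhammer_div_factorial_sq_le (a := l - 1 / 2 + 1) (by linarith)
  obtain ⟨D, hD, h3⟩ := exists_ascPochhammer_div_factorial_sq_le (a := m + 1 / 2 + 1) (by linarith)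
  -- Chosen so that `2n + 1 + 2l ≥ c(n+1)` for every `n`, also for negative `l`; hence `k ≥
  -- c(n+1)²`.
  set c := min 1 (1 + 2 * l) with hc
  have hc0 : 0 < c := lt_min one_pos (by linarith)
  refine ⟨A * (Real.exp (2 * |l| + 2 * m) * ((1 + 2 * m) ^ 2 * D / c + B)), by positivity,
    fun n s hs0 hs => ?_⟩
  have hn1 : (0 : ℝ) ≤ n := n.cast_nonneg
  have hn : (1 : ℝ) ≤ (n : ℝ) + 1 := by linarith
  have hn0 : (0 : ℝ) < (n : ℝ) + 1 := by linarith
  set k := (2 * (n : ℝ) + 1 + 2 * l) * (2 * n + 1 + 2 * m) with hk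
  have hkc : c * ((n : ℝ) + 1) ^ 2 ≤ k := by
    have a1 : c ≤ 1 := min_le_left _ _
    have a2 : c ≤ 1 + 2 * l := min_le_right _ _
    rw [hk, sq, ← mul_assoc]
    refine mul_le_mul ?_ ?_ hn0.le ?_
    · nlinarith
    · linarith
    · linarith
  have hk0 : 0 < k := lt_of_lt_of_le (by positivity) hkc
  have k2 := h2 n
  have k3 := h3 n
  rw [← shiftedJacobi_eval_one] at k2
  rw [← shiftedJacobi_eval_zero_sq (l - 1 / 2)] at k3
  have e1 : ((n : ℝ) + 1) * ((n : ℝ) + 1) ^ (2 * (l - 1 / 2 + 1 - 1))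
      ≤ ((n : ℝ) + 1) ^ (2 * max l m) := by
    rw [mul_comm, ← Real.rpow_add_one hn0.ne']
    exact Real.rpow_le_rpow_of_exponent_le hn (by linarith [le_max_left l m])
  have e2 : ((n : ℝ) + 1) * (((n : ℝ) + 1) ^ (2 * (m + 1 / 2 + 1 - 1)) / ((n : ℝ) + 1) ^ 2)
      ≤ ((n : ℝ) + 1) ^ (2 * max l m) := by
    rw [← Real.rpow_two, ← Real.rpow_sub hn0, mul_comm, ← Real.rpow_add_one hn0.ne']
    exact Real.rpow_le_rpow_of_exponent_le hn (by linarith [le_max_right l m])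
  have h4 := mul_shiftedJacobi_odd_sq_le hl hm n hs0 hs
  rw [← hk] at h4
  set x := (shiftedJacobi (l - 1 / 2) (m + 1 / 2) n).eval s
  set q0 := (shiftedJacobi (l - 1 / 2) (m + 1 / 2) n).eval 0
  set q1 := (shiftedJacobi (l - 1 / 2) (m + 1 / 2) n).eval 1
  have h5 : s * x ^ 2 ≤ Real.exp (2 * |l| + 2 * m) * ((1 + 2 * m) ^ 2 * q0 ^ 2 / k + q1 ^ 2) := by
    refine le_of_mul_le_mul_left (h4.trans_eq ?_) hk0
    field_simp
  have h6 : (1 + 2 * m) ^ 2 * q0 ^ 2 / k ≤ (1 + 2 * m) ^ 2 * D / c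
      * (((n : ℝ) + 1) ^ (2 * (m + 1 / 2 + 1 - 1)) / ((n : ℝ) + 1) ^ 2) := by
    calc _ ≤ (1 + 2 * m) ^ 2 * (D * ((n : ℝ) + 1) ^ (2 * (m + 1 / 2 + 1 - 1)))
          / (c * ((n : ℝ) + 1) ^ 2) := by gcongr
      _ = _ := by field_simp
  calc _ ≤ (A * ((n : ℝ) + 1)) * (Real.exp (2 * |l| + 2 * m)
        * ((1 + 2 * m) ^ 2 * D / c
      * (((n : ℝ) + 1) ^ (2 * (m + 1 / 2 + 1 - 1)) / ((n : ℝ) + 1) ^ 2)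
          + B * ((n : ℝ) + 1) ^ (2 * (l - 1 / 2 + 1 - 1)))) := by
        refine mul_le_mul (h1 n) (h5.trans ?_) (by positivity) (by positivity)
        gcongr
    _ = A * (Real.exp (2 * |l| + 2 * m)
        * ((1 + 2 * m) ^ 2 * D / c * (((n : ℝ) + 1) * (((n : ℝ) + 1) ^ (2 * (m + 1 / 2 + 1 - 1))
            / ((n : ℝ) + 1) ^ 2))
          + B * (((n : ℝ) + 1) * ((n : ℝ) + 1) ^ (2 * (l - 1 / 2 + 1 - 1))))) := by ring
    _ ≤ A * (Real.exp (2 * |l| + 2 * m)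
        * ((1 + 2 * m) ^ 2 * D / c * ((n : ℝ) + 1) ^ (2 * max l m)
          + B * ((n : ℝ) + 1) ^ (2 * max l m))) := by
        gcongr
    _ = _ := by ring

/-- The generalized Gegenbauer polynomials grow at most like `n ^ max(l, m)`. -/
theorem exists_abs_orthoPoly_le {l m : ℝ} (hl : -1 / 2 < l) (hm : 0 ≤ m) :
    ∃ M : ℝ, 0 < M ∧ ∀ (n : ℕ) (t : ℝ), t ∈ Set.Icc (-1 : ℝ) 1 →
      |orthoPoly l m n t| ≤ M * ((n : ℝ) + 1) ^ max l m := by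
  obtain ⟨A, hA, h1⟩ := exists_even_sq_le hl hm
  obtain ⟨B, hB, h2⟩ := exists_odd_sq_le hl hm
  refine ⟨√(A + B), by positivity, fun n t ht => ?_⟩
  have ht0 : 0 ≤ t ^ 2 := sq_nonneg t
  have ht1 : t ^ 2 ≤ 1 := by rw [sq_le_one_iff_abs_le_one]; exact abs_le.2 ht
  have hσ : 0 ≤ max l m := hm.trans (le_max_right _ _)
  have hn : (0 : ℝ) < (n : ℝ) + 1 := by positivity
  -- The Jacobi index is only half the degree; enlarging it to `n` is harmless because the exponent
  -- is nonnegative.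
  have e : ((((n / 2 : ℕ) : ℝ)) + 1) ^ (2 * max l m) ≤ (((n : ℝ) + 1) ^ max l m) ^ 2 := by
    rw [← Real.rpow_two, ← Real.rpow_mul hn.le, mul_comm (max l m)]
    refine Real.rpow_le_rpow (by positivity) ?_ (by positivity)
    have : ((n / 2 : ℕ) : ℝ) ≤ n := by exact_mod_cast Nat.div_le_self n 2
    linarith
  refine abs_le_of_sq_le_sq ?_ (by positivity)
  rw [mul_pow, Real.sq_sqrt (by positivity)]
  have hp := sq_nonneg (((n : ℝ) + 1) ^ max l m)
  rw [orthoPoly]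
  split_ifs
  · rw [jacobi_eq_shiftedJacobi_eval]
    calc _ ≤ _ := h1 (n / 2) (t ^ 2) ht0 ht1
      _ ≤ A * (((n : ℝ) + 1) ^ max l m) ^ 2 := by gcongr
      _ ≤ _ := by gcongr; linarith
  · rw [jacobi_eq_shiftedJacobi_eval, mul_pow, mul_pow]
    calc _ ≤ _ := h2 (n / 2) (t ^ 2) ht0 ht1
      _ ≤ B * (((n : ℝ) + 1) ^ max l m) ^ 2 := by gcongr
      _ ≤ _ := by gcongr; linarith

end Growth

/-! ### Orthonormality with respect to the weight. -/

section Orthonormality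

theorem integral_Ioo_rpow_mul_rpow {a b : ℝ} (ha : -1 < a) (hb : -1 < b) :
    ∫ s in Set.Ioo (0 : ℝ) 1, s ^ b * (1 - s) ^ a
      = Real.Gamma (b + 1) * Real.Gamma (a + 1) / Real.Gamma (b + 1 + (a + 1)) := by
  have ha' : 0 < a + 1 := by linarith
  have hb' : 0 < b + 1 := by linarith
  have h := ProbabilityTheory.lintegral_betaPDF_eq_one hb' ha'
  have hB := ProbabilityTheory.beta_pos hb' ha'
  rw [ProbabilityTheory.lintegral_betaPDF, ← ENNReal.toReal_eq_one_iff,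
    ← integral_eq_lintegral_of_nonneg_ae] at h
  · simp_rw [mul_assoc, integral_const_mul, add_sub_cancel_right] at h
    rw [one_div, inv_mul_eq_one₀ hB.ne'] at h
    rw [← h]
    rfl
  · refine ae_restrict_of_forall_mem measurableSet_Ioo fun x hx => ?_
    have h1 := Real.rpow_nonneg hx.1.le (b + 1 - 1)
    have h2 := Real.rpow_nonneg (sub_nonneg.2 hx.2.le) (a + 1 - 1)
    have h3 := (one_div_pos.2 hB).le
    exact mul_nonneg (mul_nonneg h3 h1) h2
  · exact Measurable.aestronglyMeasurable (by fun_prop)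

/-- The Bochner integral of a non-integrable function is 0, while the Beta value is positive. -/
theorem integrableOn_Ioo_rpow_mul_rpow {a b : ℝ} (ha : -1 < a) (hb : -1 < b) :
    IntegrableOn (fun s : ℝ => s ^ b * (1 - s) ^ a) (Set.Ioo 0 1) := by
  have ha' : 0 < a + 1 := by linarith
  have hb' : 0 < b + 1 := by linarith
  refine not_imp_comm.1 integral_undef ?_
  rw [integral_Ioo_rpow_mul_rpow ha hb]
  exact (ProbabilityTheory.beta_pos hb' ha').ne'

theorem integrableOn_eval_mul_rpow {a b : ℝ} (ha : -1 < a) (hb : -1 < b) (p : Polynomial ℝ) :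
    IntegrableOn (fun s : ℝ => p.eval s * (s ^ b * (1 - s) ^ a)) (Set.Ioo 0 1) := by
  obtain ⟨C, hC⟩ := (isCompact_Icc (a := (0 : ℝ)) (b := 1)).exists_bound_of_continuousOn
    p.continuous.continuousOn
  refine (integrableOn_Ioo_rpow_mul_rpow ha hb).bdd_mul (c := C)
    p.continuous.aestronglyMeasurable ?_
  exact ae_restrict_of_forall_mem measurableSet_Ioo fun x hx => hC x ⟨hx.1.le, hx.2.le⟩

/-- Each term is a Beta integral, and Chu–Vandermonde sums them. The resulting Pochhammer symbol
`(j+1-n)_n` vanishes for `j < n`, which is the orthogonality to lower powers, and equals `n!` for `j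
= n`. -/
theorem integral_shiftedJacobi_mul_pow {a b : ℝ} (ha : -1 < a) (hb : -1 < b) (n j : ℕ) :
    ∫ s in Set.Ioo (0 : ℝ) 1, (shiftedJacobi a b n).eval s * s ^ j * (s ^ b * (1 - s) ^ a)
      = Real.Gamma (j + b + 1) * Real.Gamma (n + a + 1)
        * (ascPochhammer ℝ n).eval ((j : ℝ) + 1 - n)
        / (n.factorial * Real.Gamma (n + (j + a + b + 2))) := by
  have hj := j.cast_nonneg (α := ℝ)
  have e1 : ∀ s ∈ Set.Ioo (0 : ℝ) 1,
      (shiftedJacobi a b n).eval s * s ^ j * (s ^ b * (1 - s) ^ a)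
      = ∑ k ∈ Finset.range (n + 1), (jacobiCoeff a b n k * (-1) ^ k)
          * (s ^ (j + b) * (1 - s) ^ (k + a)) := by
    intro s hs
    rw [shiftedJacobi_eval, Finset.sum_mul, Finset.sum_mul]
    refine Finset.sum_congr rfl fun k _ => ?_
    have h1 : 0 < 1 - s := sub_pos.2 hs.2
    rw [Real.rpow_add hs.1, Real.rpow_add h1, Real.rpow_natCast, Real.rpow_natCast,
      show s - 1 = (-1) * (1 - s) by ring, mul_pow]
    ring
  have hpos : ∀ k : ℕ, -1 < (k : ℝ) + a := fun k => by linarith [k.cast_nonneg (α := ℝ)]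
  have hjb : -1 < (j : ℝ) + b := by linarith
  rw [setIntegral_congr_fun measurableSet_Ioo e1, integral_finsetSum _ fun k _ =>
    (integrableOn_Ioo_rpow_mul_rpow (hpos k) hjb).const_mul _]
  simp_rw [integral_const_mul]
  have h := sum_choose_mul_ascPochhammer n (n + a + b + 1) (j + a + b + 2)
  rw [show (j : ℝ) + a + b + 2 - (n + a + b + 1) = j + 1 - n by ring] at h
  rw [← h, Finset.mul_sum, Finset.sum_div]
  refine Finset.sum_congr rfl fun k hk => ?_
  have hk' : k ≤ n := Nat.lt_succ_iff.mp (Finset.mem_range.mp hk)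
  have hk0 := k.cast_nonneg (α := ℝ)
  rw [integral_Ioo_rpow_mul_rpow (hpos k) hjb, jacobiCoeff_eq a b hk',
    ascPochhammer_eval_eq_Gamma_div (a := a + 1 + k) (by linarith),
    ascPochhammer_eval_eq_Gamma_div (a := j + a + b + 2 + k) (by linarith), Nat.cast_sub hk',
    show (n : ℝ) - k + (a + 1 + k) = n + a + 1 by ring,
    show (n : ℝ) - k + (j + a + b + 2 + k) = n + (j + a + b + 2) by ring,
    show (j : ℝ) + b + 1 + (k + a + 1) = j + a + b + 2 + k by ring,
    show (k : ℝ) + a + 1 = a + 1 + k by ring]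
  have g1 := (Real.Gamma_pos_of_pos (s := a + 1 + k) (by linarith)).ne'
  have g2 := (Real.Gamma_pos_of_pos (s := j + a + b + 2 + k) (by linarith)).ne'
  have g3 := (Real.Gamma_pos_of_pos (s := n + (j + a + b + 2))
    (by linarith [n.cast_nonneg (α := ℝ)])).ne'
  have hf : (n.factorial : ℝ) ≠ 0 := by exact_mod_cast n.factorial_ne_zero
  field_simp

theorem integral_shiftedJacobi_mul_eval {a b : ℝ} (ha : -1 < a) (hb : -1 < b) {n : ℕ}
    {p : Polynomial ℝ} (hp : p.natDegree ≤ n) :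
    ∫ s in Set.Ioo (0 : ℝ) 1, (shiftedJacobi a b n).eval s * p.eval s * (s ^ b * (1 - s) ^ a)
      = p.coeff n * (Real.Gamma (n + b + 1) * Real.Gamma (n + a + 1)
        / Real.Gamma (n + (n + a + b + 2))) := by
  have e1 : ∀ s ∈ Set.Ioo (0 : ℝ) 1,
      (shiftedJacobi a b n).eval s * p.eval s * (s ^ b * (1 - s) ^ a)
      = ∑ j ∈ Finset.range (n + 1), p.coeff j
          * ((shiftedJacobi a b n).eval s * s ^ j * (s ^ b * (1 - s) ^ a)) := by
    intro s _
    rw [p.eval_eq_sum_range' (Nat.lt_succ_of_le hp), Finset.mul_sum, Finset.sum_mul]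
    exact Finset.sum_congr rfl fun k _ => by ring
  have hi : ∀ j : ℕ, IntegrableOn (fun s : ℝ =>
      (shiftedJacobi a b n).eval s * s ^ j * (s ^ b * (1 - s) ^ a)) (Set.Ioo 0 1) := by
    intro j
    refine (integrableOn_eval_mul_rpow ha hb (shiftedJacobi a b n * Polynomial.X ^ j)).congr_fun
      (fun s _ => ?_) measurableSet_Ioo
    simp
  rw [setIntegral_congr_fun measurableSet_Ioo e1,
    integral_finsetSum _ fun k _ => (hi k).const_mul _]
  simp_rw [integral_const_mul, integral_shiftedJacobi_mul_pow ha hb]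
  rw [Finset.sum_range_succ, Finset.sum_eq_zero, zero_add]
  · have hf : (n.factorial : ℝ) ≠ 0 := by exact_mod_cast n.factorial_ne_zero
    rw [add_sub_cancel_left, ascPochhammer_eval_one]
    field_simp
  · intro j hj
    have hj' := Finset.mem_range.mp hj
    have : (ascPochhammer ℝ n).eval ((j : ℝ) + 1 - n) = 0 := by
      rw [show (j : ℝ) + 1 - n = -((n - 1 - j : ℕ) : ℝ) by
        rw [Nat.sub_sub, Nat.cast_sub (by omega)]; push_cast; ring]
      exact ascPochhammer_eval_neg_coe_nat_of_lt (by omega)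
    rw [this]
    simp

theorem integral_shiftedJacobi_mul_shiftedJacobi_of_lt {a b : ℝ} (ha : -1 < a) (hb : -1 < b)
    {n k : ℕ} (h : k < n) :
    ∫ s in Set.Ioo (0 : ℝ) 1, (shiftedJacobi a b n).eval s * (shiftedJacobi a b k).eval s
      * (s ^ b * (1 - s) ^ a) = 0 := by
  have hd := shiftedJacobi_natDegree_le a b k
  rw [integral_shiftedJacobi_mul_eval ha hb (hd.trans h.le),
    Polynomial.coeff_eq_zero_of_natDegree_lt (hd.trans_lt h), zero_mul]

theorem integral_shiftedJacobi_mul_shiftedJacobi_of_ne {a b : ℝ} (ha : -1 < a) (hb : -1 < b)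
    {n k : ℕ} (h : k ≠ n) :
    ∫ s in Set.Ioo (0 : ℝ) 1, (shiftedJacobi a b n).eval s * (shiftedJacobi a b k).eval s
      * (s ^ b * (1 - s) ^ a) = 0 := by
  rcases h.lt_or_gt with h | h
  · exact integral_shiftedJacobi_mul_shiftedJacobi_of_lt ha hb h
  · simp_rw [mul_comm (Polynomial.eval _ (shiftedJacobi a b n))]
    exact integral_shiftedJacobi_mul_shiftedJacobi_of_lt ha hb h

theorem integral_shiftedJacobi_sq {a b : ℝ} (ha : -1 < a) (hb : -1 < b) (n : ℕ) :
    ∫ s in Set.Ioo (0 : ℝ) 1, (shiftedJacobi a b n).eval s * (shiftedJacobi a b n).eval s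
      * (s ^ b * (1 - s) ^ a)
      = (ascPochhammer ℝ n).eval ((n : ℝ) + a + b + 1) / n.factorial
        * (Real.Gamma (n + b + 1) * Real.Gamma (n + a + 1)
        / Real.Gamma (n + (n + a + b + 2))) := by
  rw [integral_shiftedJacobi_mul_eval ha hb (shiftedJacobi_natDegree_le a b n),
    shiftedJacobi_coeff_self]

/-- The positivity condition permits writing the Pochhammer symbol as a Gamma quotient. It can fail
for `n = 0` in the even case, where `integral_shiftedJacobi_sq` is used instead. -/
theorem integral_shiftedJacobi_sq' {a b : ℝ} (ha : -1 < a) (hb : -1 < b) {n : ℕ}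
    (h : 0 < n + a + b + 1) :
    ∫ s in Set.Ioo (0 : ℝ) 1, (shiftedJacobi a b n).eval s * (shiftedJacobi a b n).eval s
      * (s ^ b * (1 - s) ^ a)
      = Real.Gamma (n + b + 1) * Real.Gamma (n + a + 1)
        / ((2 * n + a + b + 1) * Real.Gamma (n + 1) * Real.Gamma (n + a + b + 1)) := by
  have hn := n.cast_nonneg (α := ℝ)
  rw [integral_shiftedJacobi_sq ha hb, ascPochhammer_eval_eq_Gamma_div h,
    Real.Gamma_nat_eq_factorial,
    show (n : ℝ) + (n + a + b + 2) = n + (n + a + b + 1) + 1 by ring,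
    Real.Gamma_add_one (s := n + (n + a + b + 1)) (by linarith)]
  have g1 := (Real.Gamma_pos_of_pos (s := n + (n + a + b + 1)) (by linarith)).ne'
  have g2 := (Real.Gamma_pos_of_pos h).ne'
  have hf : (n.factorial : ℝ) ≠ 0 := by exact_mod_cast n.factorial_ne_zero
  have h3 : 2 * n + a + b + 1 ≠ 0 := by linarith
  rw [show (n : ℝ) + (n + a + b + 1) = 2 * n + a + b + 1 by ring] at g1 ⊢
  field_simp

theorem weight_nonneg {l m t : ℝ} (ht : t ∈ Set.Icc (-1 : ℝ) 1) : 0 ≤ weight l m t := by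
  have : t ^ 2 ≤ 1 := by rw [sq_le_one_iff_abs_le_one]; exact abs_le.2 ht
  exact mul_nonneg (Real.rpow_nonneg (abs_nonneg _) _)
    (Real.rpow_nonneg (sub_nonneg.2 this) _)

theorem measurable_weight (l m : ℝ) : Measurable (weight l m) := by
  unfold weight
  fun_prop

theorem integral_weightMeasure (l m : ℝ) (F : ℝ → ℝ) :
    ∫ t, F t ∂(weightMeasure l m) = ∫ t in Set.Icc (-1 : ℝ) 1, weight l m t * F t := by
  rw [weightMeasure, integral_withDensity_eq_integral_toReal_smul
    (measurable_weight l m).ennreal_ofReal (by simp)]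
  refine setIntegral_congr_fun measurableSet_Icc fun t ht => ?_
  rw [smul_eq_mul, ENNReal.toReal_ofReal (weight_nonneg ht)]

/-- Fold by evenness and substitute `s = t^2`; the factor 2 from folding cancels the Jacobian. No
integrability of `F` is assumed, so the identity can also serve to prove that the measure is finite.
-/
theorem integral_comp_sq_weightMeasure (l m : ℝ) (F : ℝ → ℝ) :
    ∫ t, F (t ^ 2) ∂(weightMeasure l m)
      = ∫ s in Set.Ioo (0 : ℝ) 1, F s * (s ^ (m - 1 / 2) * (1 - s) ^ (l - 1 / 2)) := by
  -- The cutoff at 1 is moved into the integrand, so that folding over `ℝ` and the power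
  -- substitution on `(0, ∞)` apply.
  set g : ℝ → ℝ := (Set.Iic (1 : ℝ)).indicator fun r => weight l m r * F (r ^ 2) with hg
  set h : ℝ → ℝ := (Set.Iic (1 : ℝ)).indicator
    fun s => F s * (s ^ (m - 1 / 2) * (1 - s) ^ (l - 1 / 2)) with hh
  have e1 : ∀ t : ℝ, (Set.Icc (-1 : ℝ) 1).indicator (fun t => weight l m t * F (t ^ 2)) t
      = g |t| := by
    intro t
    by_cases ht : |t| ≤ 1
    · rw [hg, Set.indicator_of_mem (Set.mem_Icc.2 (abs_le.1 ht)),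
        Set.indicator_of_mem (Set.mem_Iic.2 ht)]
      simp [weight]
    · rw [hg, Set.indicator_of_notMem (by rwa [Set.mem_Icc, ← abs_le]),
        Set.indicator_of_notMem (by exact ht)]
  have e2 : ∀ x ∈ Set.Ioi (0 : ℝ), (2 * x ^ ((2 : ℝ) - 1)) • h (x ^ (2 : ℝ)) = 2 * g x := by
    intro x (hx : 0 < x)
    rw [Real.rpow_two, hg, hh]
    by_cases hx1 : x ≤ 1
    · have hx2 : x ^ 2 ≤ 1 := pow_le_one₀ hx.le hx1
      rw [Set.indicator_of_mem (by exact hx2), Set.indicator_of_mem (by exact hx1), weight,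
        abs_of_pos hx, ← Real.rpow_two, ← Real.rpow_mul hx.le,
        show 2 * m = (2 - 1) + 2 * (m - 1 / 2) by ring, Real.rpow_add hx, smul_eq_mul]
      ring
    · have hx2 : ¬ x ^ 2 ≤ 1 := by rw [sq_le_one_iff₀ hx.le]; exact hx1
      rw [Set.indicator_of_notMem (by exact hx2), Set.indicator_of_notMem (by exact hx1)]
      simp
  rw [integral_weightMeasure, ← integral_indicator measurableSet_Icc]
  simp_rw [e1]
  rw [integral_comp_abs, ← integral_const_mul, ← setIntegral_congr_fun measurableSet_Ioi e2,
    integral_comp_rpow_Ioi_of_pos two_pos, hh, setIntegral_indicator measurableSet_Iic,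
    Set.Ioi_inter_Iic, integral_Ioc_eq_integral_Ioo]

theorem integral_mul_comp_sq_weightMeasure (l m : ℝ) (F : ℝ → ℝ) :
    ∫ t, t * F (t ^ 2) ∂(weightMeasure l m) = 0 := by
  rw [integral_weightMeasure, ← integral_indicator measurableSet_Icc]
  set g := (Set.Icc (-1 : ℝ) 1).indicator (fun t => weight l m t * (t * F (t ^ 2))) with hg
  have h : ∀ t, g (-t) = - g t := by
    intro t
    by_cases ht : t ∈ Set.Icc (-1 : ℝ) 1
    · have ht' : -t ∈ Set.Icc (-1 : ℝ) 1 := ⟨by linarith [ht.2], by linarith [ht.1]⟩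
      rw [hg, Set.indicator_of_mem ht, Set.indicator_of_mem ht']
      simp [weight]
    · have ht' : -t ∉ Set.Icc (-1 : ℝ) 1 := fun h => ht ⟨by linarith [h.2], by linarith [h.1]⟩
      rw [hg, Set.indicator_of_notMem ht, Set.indicator_of_notMem ht', neg_zero]
  have h2 := integral_neg_eq_self g volume
  simp_rw [h, integral_neg] at h2
  linarith

theorem integral_sq_comp_sq_weightMeasure (l m : ℝ) (F : ℝ → ℝ) :
    ∫ t, t ^ 2 * F (t ^ 2) ∂(weightMeasure l m)
      = ∫ s in Set.Ioo (0 : ℝ) 1, F s * (s ^ (m + 1 / 2) * (1 - s) ^ (l - 1 / 2)) := by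
  rw [integral_comp_sq_weightMeasure l m fun s => s * F s]
  refine setIntegral_congr_fun measurableSet_Ioo fun s hs => ?_
  rw [show m + 1 / 2 = m - 1 / 2 + 1 by ring, Real.rpow_add_one hs.1.ne']
  ring

theorem evenFactor_sq_mul {l m : ℝ} (hl : -1 / 2 < l) (hm : 0 ≤ m) (n : ℕ) :
    evenFactor l m n ^ 2 * ∫ s in Set.Ioo (0 : ℝ) 1,
      (shiftedJacobi (l - 1 / 2) (m - 1 / 2) n).eval s
      * (shiftedJacobi (l - 1 / 2) (m - 1 / 2) n).eval s
      * (s ^ (m - 1 / 2) * (1 - s) ^ (l - 1 / 2)) = 1 := by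
  have g1 : 0 < Real.Gamma (n + l + 1 / 2) :=
    Real.Gamma_pos_of_pos (by linarith [n.cast_nonneg (α := ℝ)])
  have g2 : 0 < Real.Gamma (n + m + 1 / 2) :=
    Real.Gamma_pos_of_pos (by linarith [n.cast_nonneg (α := ℝ)])
  rcases n with _ | n
  · have g3 : 0 < Real.Gamma (l + m + 1) := Real.Gamma_pos_of_pos (by linarith)
    rw [integral_shiftedJacobi_sq (by linarith) (by linarith), evenFactor]
    simp only [CharP.cast_eq_zero, zero_add, ascPochhammer_zero, Polynomial.eval_one,
      Nat.factorial_zero, Nat.cast_one, div_one, one_mul] at g1 g2 ⊢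
    rw [Real.sq_sqrt (by positivity), show m - 1 / 2 + 1 = m + 1 / 2 by ring,
      show l - 1 / 2 + 1 = l + 1 / 2 by ring,
      show l - 1 / 2 + (m - 1 / 2) + 2 = l + m + 1 by ring]
    generalize Real.Gamma (l + 1 / 2) = x at *
    generalize Real.Gamma (m + 1 / 2) = y at *
    field_simp
  · rw [evenFactor]
    have hN : (1 : ℝ) ≤ ((n + 1 : ℕ) : ℝ) := by push_cast; linarith [n.cast_nonneg (α := ℝ)]
    rw [integral_shiftedJacobi_sq' (by linarith) (by linarith) (by linarith)]
    set N : ℝ := ((n + 1 : ℕ) : ℝ)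
    have g3 : 0 < Real.Gamma (N + l + m) := Real.Gamma_pos_of_pos (by linarith)
    have g4 : 0 < Real.Gamma (N + 1) := Real.Gamma_pos_of_pos (by linarith)
    have g5 : 0 < 2 * N + l + m := by linarith
    rw [Real.sq_sqrt (by positivity), show N + (m - 1 / 2) + 1 = N + m + 1 / 2 by ring,
      show N + (l - 1 / 2) + 1 = N + l + 1 / 2 by ring,
      show 2 * N + (l - 1 / 2) + (m - 1 / 2) + 1 = 2 * N + l + m by ring,
      show N + (l - 1 / 2) + (m - 1 / 2) + 1 = N + l + m by ring]
    generalize Real.Gamma (N + l + 1 / 2) = x at *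
    generalize Real.Gamma (N + m + 1 / 2) = y at *
    field_simp

theorem oddFactor_sq_mul {l m : ℝ} (hl : -1 / 2 < l) (hm : 0 ≤ m) (n : ℕ) :
    oddFactor l m n ^ 2 * ∫ s in Set.Ioo (0 : ℝ) 1,
      (shiftedJacobi (l - 1 / 2) (m + 1 / 2) n).eval s
      * (shiftedJacobi (l - 1 / 2) (m + 1 / 2) n).eval s
      * (s ^ (m + 1 / 2) * (1 - s) ^ (l - 1 / 2)) = 1 := by
  have hn := n.cast_nonneg (α := ℝ)
  have g1 : 0 < Real.Gamma (n + l + 1 / 2) := Real.Gamma_pos_of_pos (by linarith)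
  have g2 : 0 < Real.Gamma (n + m + 3 / 2) := Real.Gamma_pos_of_pos (by linarith)
  have g3 : 0 < Real.Gamma (n + l + m + 1) := Real.Gamma_pos_of_pos (by linarith)
  have g4 : 0 < Real.Gamma ((n : ℝ) + 1) := Real.Gamma_pos_of_pos (by linarith)
  have g5 : 0 < 2 * n + l + m + 1 := by linarith
  rw [integral_shiftedJacobi_sq' (by linarith) (by linarith) (by linarith), oddFactor,
    Real.sq_sqrt (by positivity), show (n : ℝ) + (m + 1 / 2) + 1 = n + m + 3 / 2 by ring,
      show (n : ℝ) + (l - 1 / 2) + 1 = n + l + 1 / 2 by ring,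
      show 2 * (n : ℝ) + (l - 1 / 2) + (m + 1 / 2) + 1 = 2 * n + l + m + 1 by ring,
      show (n : ℝ) + (l - 1 / 2) + (m + 1 / 2) + 1 = n + l + m + 1 by ring]
  generalize Real.Gamma (n + l + 1 / 2) = x at *
  generalize Real.Gamma (n + m + 3 / 2) = y at *
  field_simp

/-- Opposite parities give an odd integrand. For equal parities the substitution `s = t^2` reduces
to Jacobi orthogonality; in the odd case the extra `t^2` raises the exponent of `s` to `m + 1/2`. -/
theorem integral_orthoPoly_mul_orthoPoly {l m : ℝ} (hl : -1 / 2 < l) (hm : 0 ≤ m) (i j : ℕ) :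
    ∫ t, orthoPoly l m i t * orthoPoly l m j t ∂(weightMeasure l m) = if i = j then 1 else 0 := by
  have ha : -1 < l - 1 / 2 := by linarith
  simp only [orthoPoly, jacobi_eq_shiftedJacobi_eval]
  by_cases hi : Even i <;> by_cases hj : Even j
  · simp only [hi, hj, if_true]
    have := integral_comp_sq_weightMeasure l m fun s => (evenFactor l m (i / 2)
      * evenFactor l m (j / 2)) * ((shiftedJacobi (l - 1 / 2) (m - 1 / 2) (i / 2)).eval s
        * (shiftedJacobi (l - 1 / 2) (m - 1 / 2) (j / 2)).eval s)
    simp_rw [mul_mul_mul_comm (evenFactor l m (i / 2))]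
    rw [this]
    simp_rw [mul_assoc (evenFactor l m (i / 2) * evenFactor l m (j / 2)), integral_const_mul]
    split_ifs with h
    · rw [h, ← sq, evenFactor_sq_mul hl hm]
    · rw [integral_shiftedJacobi_mul_shiftedJacobi_of_ne ha (by linarith), mul_zero]
      obtain ⟨a, rfl⟩ := hi
      obtain ⟨b, rfl⟩ := hj
      omega
  · rw [if_neg (by rintro rfl; exact hj hi)]
    simp only [hi, hj, if_true, if_false]
    convert! integral_mul_comp_sq_weightMeasure l m fun s => (evenFactor l m (i / 2)
      * oddFactor l m (j / 2)) * ((shiftedJacobi (l - 1 / 2) (m - 1 / 2) (i / 2)).eval s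
        * (shiftedJacobi (l - 1 / 2) (m + 1 / 2) (j / 2)).eval s) using 3
    ring
  · rw [if_neg (by rintro rfl; exact hi hj)]
    simp only [hi, hj, if_true, if_false]
    convert! integral_mul_comp_sq_weightMeasure l m fun s => (oddFactor l m (i / 2)
      * evenFactor l m (j / 2)) * ((shiftedJacobi (l - 1 / 2) (m + 1 / 2) (i / 2)).eval s
        * (shiftedJacobi (l - 1 / 2) (m - 1 / 2) (j / 2)).eval s) using 3
    ring
  · simp only [hi, hj, if_false]
    have := integral_sq_comp_sq_weightMeasure l m fun s => (oddFactor l m (i / 2)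
      * oddFactor l m (j / 2)) * ((shiftedJacobi (l - 1 / 2) (m + 1 / 2) (i / 2)).eval s
        * (shiftedJacobi (l - 1 / 2) (m + 1 / 2) (j / 2)).eval s)
    simp_rw [mul_mul_mul_comm (oddFactor l m (i / 2)), mul_mul_mul_comm _ (Polynomial.eval _ _),
      ← sq, mul_left_comm _ (_ ^ 2)]
    rw [this]
    simp_rw [mul_assoc (oddFactor l m (i / 2) * oddFactor l m (j / 2)), integral_const_mul]
    split_ifs with h
    · rw [h, ← sq, oddFactor_sq_mul hl hm]
    · rw [integral_shiftedJacobi_mul_shiftedJacobi_of_ne ha (by linarith), mul_zero]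
      rw [Nat.not_even_iff_odd] at hi hj
      obtain ⟨a, rfl⟩ := hi
      obtain ⟨b, rfl⟩ := hj
      omega

theorem isFiniteMeasure_weightMeasure {l m : ℝ} (hl : -1 / 2 < l) (hm : 0 ≤ m) :
    IsFiniteMeasure (weightMeasure l m) := by
  have h : Integrable (fun _ : ℝ => (1 : ℝ)) (weightMeasure l m) := by
    refine not_imp_comm.1 integral_undef ?_
    rw [integral_comp_sq_weightMeasure l m fun _ => 1]
    simp_rw [one_mul]
    rw [integral_Ioo_rpow_mul_rpow (by linarith) (by linarith)]
    exact (ProbabilityTheory.beta_pos (by linarith) (by linarith)).ne'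
  exact (integrable_const_iff_isFiniteMeasure one_ne_zero).1 h

theorem ae_weightMeasure_mem_Icc (l m : ℝ) :
    ∀ᵐ t ∂(weightMeasure l m), t ∈ Set.Icc (-1 : ℝ) 1 :=
  (withDensity_absolutelyContinuous _ _).ae_le (ae_restrict_mem measurableSet_Icc)

theorem continuous_orthoPoly (l m : ℝ) (n : ℕ) : Continuous (orthoPoly l m n) := by
  unfold orthoPoly
  simp only [jacobi_eq_shiftedJacobi_eval]
  split_ifs <;> fun_prop

end Orthonormality

/-! ### Weighted Hausdorff–Young for bounded orthonormal systems, by real interpolation. -/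

open scoped ENNReal

/-- An orthonormal system of bounded real functions, with `|e n| ≤ M * w n` almost everywhere. -/
structure IsBoundedOrthonormal {α : Type*} [MeasurableSpace α] (μ : Measure α) (e : ℕ → α → ℝ)
    (w : ℕ → ℝ) (M : ℝ) : Prop where
  measurable : ∀ n, Measurable (e n)
  bound_pos : 0 < M
  weight_pos : ∀ n, 0 < w n
  abs_le : ∀ n, ∀ᵐ t ∂μ, |e n t| ≤ M * w n
  integral_mul : ∀ i j, ∫ t, e i t * e j t ∂μ = if i = j then 1 else 0

namespace IsBoundedOrthonormal

variable {α : Type*} [MeasurableSpace α] {μ : Measure α} {e : ℕ → α → ℝ}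
  {w : ℕ → ℝ} {M : ℝ}

theorem memLp_ofReal [IsFiniteMeasure μ] (h : IsBoundedOrthonormal μ e w M) (n : ℕ) (p : ℝ≥0∞) :
    MemLp (fun t => (e n t : ℂ)) p μ := by
  refine MemLp.of_bound (C := M * w n)
    (Complex.measurable_ofReal.comp (h.measurable n)).aestronglyMeasurable ?_
  filter_upwards [h.abs_le n] with t ht
  simpa using ht

theorem integrable_mul (h : IsBoundedOrthonormal μ e w M) {f : α → ℂ} (hf : Integrable f μ)
    (n : ℕ) : Integrable (fun t => f t * (e n t : ℂ)) μ := by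
  refine hf.mul_bdd (c := M * w n)
    (Complex.measurable_ofReal.comp (h.measurable n)).aestronglyMeasurable ?_
  filter_upwards [h.abs_le n] with t ht
  simpa using ht

/-- The L¹ endpoint of the interpolation. -/
theorem enorm_coeff_le (h : IsBoundedOrthonormal μ e w M) (f : α → ℂ) (n : ℕ) :
    ‖∫ t, f t * (e n t : ℂ) ∂μ‖ₑ ≤ ENNReal.ofReal (M * w n) * ∫⁻ t, ‖f t‖ₑ ∂μ := by
  refine (enorm_integral_le_lintegral_enorm _).trans ?_
  rw [← lintegral_const_mul' _ _ ENNReal.ofReal_ne_top]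
  refine lintegral_mono_ae ?_
  filter_upwards [h.abs_le n] with t ht
  rw [enorm_mul, mul_comm]
  gcongr
  rw [← ofReal_norm]
  exact ENNReal.ofReal_le_ofReal (by simpa using ht)

/-- Bessel's inequality. -/
theorem tsum_enorm_coeff_sq_le [IsFiniteMeasure μ] (h : IsBoundedOrthonormal μ e w M) {f : α → ℂ}
    (hf : AEStronglyMeasurable f μ) :
    ∑' n, ‖∫ t, f t * (e n t : ℂ) ∂μ‖ₑ ^ 2 ≤ ∫⁻ t, ‖f t‖ₑ ^ 2 ∂μ := by
  by_cases htop : ∫⁻ t, ‖f t‖ₑ ^ 2 ∂μ = ∞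
  · rw [htop]; exact le_top
  have hf2 : MemLp f 2 μ := by
    refine ⟨hf, ?_⟩
    rw [eLpNorm_lt_top_iff_lintegral_rpow_enorm_lt_top two_ne_zero ENNReal.ofNat_ne_top]
    simpa using lt_top_iff_ne_top.2 htop
  set v : ℕ → Lp ℂ 2 μ := fun n => (h.memLp_ofReal n 2).toLp with hv
  have hinner : ∀ n (g : α → ℂ) (hg : MemLp g 2 μ),
      inner ℂ (v n) (hg.toLp) = ∫ t, g t * (e n t : ℂ) ∂μ := by
    intro n g hg
    rw [L2.inner_def]
    refine integral_congr_ae ?_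
    filter_upwards [hg.coeFn_toLp, (h.memLp_ofReal n 2).coeFn_toLp] with t h1 h2
    simp [hv, h1, h2, RCLike.inner_apply]
  have hon : Orthonormal ℂ v := by
    rw [orthonormal_iff_ite]
    intro i j
    have h1 := h.integral_mul i j
    rw [hinner i _ (h.memLp_ofReal j 2)]
    simp_rw [← Complex.ofReal_mul]
    rw [integral_complex_ofReal]
    simp_rw [mul_comm (e j _), h1]
    split_ifs <;> simp
  have hsum := hon.inner_products_summable hf2.toLp
  have hle := hon.tsum_inner_products_le hf2.toLp
  simp_rw [hinner _ f hf2] at hsum hle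
  have h1 : ∑' n, ‖∫ t, f t * (e n t : ℂ) ∂μ‖ₑ ^ 2
      = ENNReal.ofReal (∑' n, ‖∫ t, f t * (e n t : ℂ) ∂μ‖ ^ 2) := by
    rw [ENNReal.ofReal_tsum_of_nonneg (fun _ => by positivity) hsum]
    simp_rw [ENNReal.ofReal_pow (norm_nonneg _), ofReal_norm]
  rw [h1]
  refine (ENNReal.ofReal_le_ofReal hle).trans_eq ?_
  rw [Lp.norm_toLp, ENNReal.ofReal_pow ENNReal.toReal_nonneg, ENNReal.ofReal_toReal hf2.2.ne]
  rw [eLpNorm_eq_lintegral_rpow_enorm_toReal two_ne_zero ENNReal.ofNat_ne_top]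
  simp only [ENNReal.toReal_ofNat, ENNReal.rpow_ofNat]
  rw [← ENNReal.rpow_natCast, ← ENNReal.rpow_mul]
  norm_num

/-- The measure on `ℕ` that gives mass `w n ^ 2` to `n`. -/
def sqMeasure (w : ℕ → ℝ) : Measure ℕ :=
  Measure.sum fun n => ENNReal.ofReal (w n ^ 2) • Measure.dirac n

theorem lintegral_sqMeasure (w : ℕ → ℝ) (g : ℕ → ℝ≥0∞) :
    ∫⁻ n, g n ∂(sqMeasure w) = ∑' n, ENNReal.ofReal (w n ^ 2) * g n := by
  simp [sqMeasure, lintegral_sum_measure]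

/-- The distributional estimate: cut `f` where `x * ‖f‖ ^ (p - 1)` exceeds `2 * M * N`. -/
theorem sqMeasure_coeff_gt_le [IsFiniteMeasure μ] (h : IsBoundedOrthonormal μ e w M) {p N : ℝ} (hN : 0 < N)
    {f : α → ℂ} (hf : Measurable f) (hfi : Integrable f μ) (hp : 1 < p)
    (hfN : ∫⁻ t, ENNReal.ofReal (‖f t‖ ^ p) ∂μ ≤ ENNReal.ofReal N) {x : ℝ} (hx : 0 < x) :
    sqMeasure w {n | x < ‖∫ t, f t * (e n t : ℂ) ∂μ‖ / w n}
      ≤ ENNReal.ofReal (4 / x ^ 2)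
        * ∫⁻ t in {t | x * ‖f t‖ ^ (p - 1) ≤ 2 * M * N}, ‖f t‖ₑ ^ 2 ∂μ := by
  have hM := h.bound_pos
  set A := {t | x * ‖f t‖ ^ (p - 1) ≤ 2 * M * N} with hA
  have hAm : MeasurableSet A := measurableSet_le (by fun_prop) measurable_const
  -- Off `A` one has `‖f‖ ≤ x ‖f‖^p / (2MN)`. The cut is chosen so that the large part contributes
  -- at most `x/2` to each normalized coefficient.
  have hlarge : ∫⁻ t, ‖Aᶜ.indicator f t‖ₑ ∂μ ≤ ENNReal.ofReal (x / (2 * M)) := by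
    calc ∫⁻ t, ‖Aᶜ.indicator f t‖ₑ ∂μ
        ≤ ∫⁻ t, ENNReal.ofReal (x / (2 * M * N)) * ENNReal.ofReal (‖f t‖ ^ p) ∂μ := by
          refine lintegral_mono fun t => ?_
          rw [← ENNReal.ofReal_mul (by positivity), ← ofReal_norm]
          refine ENNReal.ofReal_le_ofReal ?_
          by_cases ht : t ∈ A
          · rw [Set.indicator_of_notMem (by simpa using ht), norm_zero]
            positivity
          · rw [Set.indicator_of_mem (by exact ht)]
            have ht' : 2 * M * N < x * ‖f t‖ ^ (p - 1) := not_le.1 ht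
            rw [div_mul_eq_mul_div, le_div_iff₀ (by positivity)]
            have e1 : ‖f t‖ ^ p = ‖f t‖ * ‖f t‖ ^ (p - 1) := by
              rw [← Real.rpow_one_add' (norm_nonneg _) (by linarith)]
              congr 1; ring
            rw [e1]
            nlinarith [norm_nonneg (f t)]
      _ ≤ ENNReal.ofReal (x / (2 * M * N)) * ENNReal.ofReal N := by
          rw [lintegral_const_mul' _ _ ENNReal.ofReal_ne_top]
          gcongr
      _ = _ := by
          rw [← ENNReal.ofReal_mul (by positivity)]
          congr 1
          field_simp
  have hsub : {n | x < ‖∫ t, f t * (e n t : ℂ) ∂μ‖ / w n} ⊆ {n | ENNReal.ofReal ((x / 2) ^ 2)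
      ≤ ENNReal.ofReal ((‖∫ t, A.indicator f t * (e n t : ℂ) ∂μ‖ / w n) ^ 2)} := by
    intro n (hn : x < _)
    have hw := h.weight_pos n
    have h1 : ∫ t, f t * (e n t : ℂ) ∂μ = ∫ t, A.indicator f t * (e n t : ℂ) ∂μ
        + ∫ t, Aᶜ.indicator f t * (e n t : ℂ) ∂μ := by
      rw [← integral_add (h.integrable_mul (hfi.indicator hAm) n)
        (h.integrable_mul (hfi.indicator hAm.compl) n)]
      refine integral_congr_ae (Eventually.of_forall fun t => ?_)
      simp only [← add_mul, Set.indicator_self_add_compl_apply]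
    have h2 : ‖∫ t, Aᶜ.indicator f t * (e n t : ℂ) ∂μ‖ ≤ w n * (x / 2) := by
      have h3 := (h.enorm_coeff_le (Aᶜ.indicator f) n).trans (mul_le_mul_right hlarge _)
      rw [← ofReal_norm, ← ENNReal.ofReal_mul (by positivity),
        ENNReal.ofReal_le_ofReal_iff (by positivity)] at h3
      refine h3.trans_eq ?_
      field_simp
    refine ENNReal.ofReal_le_ofReal (pow_le_pow_left₀ (by positivity) ?_ 2)
    rw [lt_div_iff₀ hw, h1] at hn
    have h4 := norm_add_le (∫ t, A.indicator f t * (e n t : ℂ) ∂μ)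
      (∫ t, Aᶜ.indicator f t * (e n t : ℂ) ∂μ)
    rw [le_div_iff₀ hw]
    linarith
  -- Hence the small part must exceed level `x/2`. In Markov's inequality the mass `w n ^ 2` cancels
  -- the normalization, leaving the plain square sum for Bessel.
  have hmarkov := mul_meas_ge_le_lintegral (μ := sqMeasure w)
    (f := fun n => ENNReal.ofReal ((‖∫ t, A.indicator f t * (e n t : ℂ) ∂μ‖ / w n) ^ 2))
    (measurable_of_countable _) (ENNReal.ofReal ((x / 2) ^ 2))
  rw [lintegral_sqMeasure] at hmarkov
  have hbessel := h.tsum_enorm_coeff_sq_le (hf.indicator hAm).aestronglyMeasurable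
  have e2 : ∀ n, ENNReal.ofReal (w n ^ 2)
      * ENNReal.ofReal ((‖∫ t, A.indicator f t * (e n t : ℂ) ∂μ‖ / w n) ^ 2)
      = ‖∫ t, A.indicator f t * (e n t : ℂ) ∂μ‖ₑ ^ 2 := by
    intro n
    have hw := (h.weight_pos n).ne'
    rw [← ENNReal.ofReal_mul (by positivity), ← ofReal_norm,
      ← ENNReal.ofReal_pow (norm_nonneg _)]
    congr 1
    field_simp
  simp_rw [e2] at hmarkov
  have e3 : ∫⁻ t, ‖A.indicator f t‖ₑ ^ 2 ∂μ = ∫⁻ t in A, ‖f t‖ₑ ^ 2 ∂μ := by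
    rw [← lintegral_indicator hAm]
    refine lintegral_congr fun t => ?_
    by_cases ht : t ∈ A <;> simp [ht]
  rw [e3] at hbessel
  have e4 : ENNReal.ofReal (4 / x ^ 2) * ENNReal.ofReal ((x / 2) ^ 2) = 1 := by
    rw [← ENNReal.ofReal_mul (by positivity), ENNReal.ofReal_eq_one]
    field_simp
    norm_num
  calc _ ≤ sqMeasure w {n | ENNReal.ofReal ((x / 2) ^ 2)
      ≤ ENNReal.ofReal ((‖∫ t, A.indicator f t * (e n t : ℂ) ∂μ‖ / w n) ^ 2)} :=
        measure_mono hsub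
    _ = ENNReal.ofReal (4 / x ^ 2) * (ENNReal.ofReal ((x / 2) ^ 2)
        * sqMeasure w {n | ENNReal.ofReal ((x / 2) ^ 2)
      ≤ ENNReal.ofReal ((‖∫ t, A.indicator f t * (e n t : ℂ) ∂μ‖ / w n) ^ 2)}) := by
        rw [← mul_assoc, e4, one_mul]
    _ ≤ _ := by gcongr; exact hmarkov.trans hbessel

theorem lintegral_Ioc_rpow {r X : ℝ} (hr : -1 < r) (hX : 0 ≤ X) :
    ∫⁻ x in Set.Ioc 0 X, ENNReal.ofReal (x ^ r) = ENNReal.ofReal (X ^ (r + 1) / (r + 1)) := by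
  rw [← ofReal_integral_eq_lintegral_ofReal
    ((intervalIntegrable_iff_integrableOn_Ioc_of_le hX).1
      (intervalIntegral.intervalIntegrable_rpow' hr)), ← intervalIntegral.integral_of_le hX,
    integral_rpow (Or.inl hr), Real.zero_rpow (by linarith), sub_zero]
  exact ae_restrict_of_forall_mem measurableSet_Ioc fun x hx => Real.rpow_nonneg hx.1.le _

/-- The weak-type estimates integrate to a strong-type estimate. -/
theorem tsum_sq_mul_coeff_rpow_le [IsFiniteMeasure μ] (h : IsBoundedOrthonormal μ e w M) {p q N : ℝ} (hN : 0 < N)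
    {f : α → ℂ} (hf : Measurable f) (hfi : Integrable f μ) (hp : 1 < p) (hq : 2 < q)
    (hpq : 1 / p + 1 / q = 1)
    (hfN : ∫⁻ t, ENNReal.ofReal (‖f t‖ ^ p) ∂μ ≤ ENNReal.ofReal N) :
    ∑' n, ENNReal.ofReal (w n ^ 2 * (‖∫ t, f t * (e n t : ℂ) ∂μ‖ / w n) ^ q)
      ≤ ENNReal.ofReal (q * (4 / (q - 2) * (2 * M) ^ (q - 2)) * N ^ (q - 1)) := by
  have hM := h.bound_pos
  have hpq' : p + q = p * q := by
    have : p ≠ 0 := by linarith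
    have : q ≠ 0 := by linarith
    field_simp at hpq
    linarith
  set K := 2 * M * N with hK
  have hK0 : 0 < K := by positivity
  have e1 : ∑' n, ENNReal.ofReal (w n ^ 2 * (‖∫ t, f t * (e n t : ℂ) ∂μ‖ / w n) ^ q)
      = ∫⁻ n, ENNReal.ofReal ((‖∫ t, f t * (e n t : ℂ) ∂μ‖ / w n) ^ q) ∂(sqMeasure w) := by
    rw [lintegral_sqMeasure]
    simp_rw [ENNReal.ofReal_mul (sq_nonneg (w _))]
  set S : Set (ℝ × α) := {x | x.1 * ‖f x.2‖ ^ (p - 1) ≤ K} with hS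
  have hSm : MeasurableSet S := measurableSet_le (by fun_prop) measurable_const
  set H : ℝ → α → ℝ≥0∞ := fun x t =>
    S.indicator (fun y => ENNReal.ofReal (4 * y.1 ^ (q - 3)) * ‖f y.2‖ₑ ^ 2) (x, t) with hH
  have hHm : Measurable (Function.uncurry H) := by
    have : Function.uncurry H
      = S.indicator (fun y => ENNReal.ofReal (4 * y.1 ^ (q - 3)) * ‖f y.2‖ₑ ^ 2) := rfl
    rw [this]
    exact Measurable.indicator (by fun_prop) hSm
  have e2 : ∫⁻ x in Set.Ioi (0 : ℝ), sqMeasure w {n | x < ‖∫ t, f t * (e n t : ℂ) ∂μ‖ / w n}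
        * ENNReal.ofReal (x ^ (q - 1)) ≤ ∫⁻ x in Set.Ioi (0 : ℝ), ∫⁻ t, H x t ∂μ := by
    refine setLIntegral_mono' measurableSet_Ioi fun x (hx : 0 < x) => ?_
    have hAm : MeasurableSet {t | x * ‖f t‖ ^ (p - 1) ≤ K} :=
      measurableSet_le (by fun_prop) measurable_const
    have hH' : ∀ t, H x t = ENNReal.ofReal (4 * x ^ (q - 3))
        * {t | x * ‖f t‖ ^ (p - 1) ≤ K}.indicator (fun t => ‖f t‖ₑ ^ 2) t := by
      intro t
      by_cases ht : x * ‖f t‖ ^ (p - 1) ≤ K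
      · rw [hH, Set.indicator_of_mem (by exact ht)]
        simp only
        rw [Set.indicator_of_mem (by exact ht)]
      · simp only [hH]
        rw [Set.indicator_of_notMem (by exact ht), Set.indicator_of_notMem (by exact ht), mul_zero]
    simp_rw [hH']
    rw [lintegral_const_mul' _ _ ENNReal.ofReal_ne_top, lintegral_indicator hAm]
    refine (mul_le_mul_left (h.sqMeasure_coeff_gt_le hN hf hfi hp hfN hx) _).trans_eq ?_
    rw [mul_right_comm, ← ENNReal.ofReal_mul (by positivity)]
    congr 2
    rw [show q - 1 = (q - 3) + 2 by ring, Real.rpow_add hx, Real.rpow_two]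
    field_simp
  -- For fixed `t` the cut confines `x` to `(0, K r^(1-p)]`, where `x^(q-3)` is integrable because
  -- `q > 2`. The resulting power of `r` is `2 + (1-p)(q-2) = p` by conjugacy.
  have e3 : ∀ t, ∫⁻ x in Set.Ioi (0 : ℝ), H x t
      = ENNReal.ofReal (4 / (q - 2) * K ^ (q - 2)) * ENNReal.ofReal (‖f t‖ ^ p) := by
    intro t
    rcases eq_or_ne (f t) 0 with h0 | h0
    · have : ∀ x, H x t = 0 := fun x => by
        simp only [hH]
        by_cases hx : (x, t) ∈ S
        · rw [Set.indicator_of_mem hx]; simp [h0]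
        · rw [Set.indicator_of_notMem hx]
      simp [this, h0, Real.zero_rpow (by linarith : p ≠ 0)]
    have hr : 0 < ‖f t‖ := norm_pos_iff.2 h0
    set r := ‖f t‖ with hrdef
    have hX : 0 ≤ K * r ^ (1 - p) := by positivity
    have hH' : ∀ x, H x t = (Set.Iic (K * r ^ (1 - p))).indicator
        (fun x => ENNReal.ofReal (4 * r ^ 2) * ENNReal.ofReal (x ^ (q - 3))) x := by
      intro x
      have hiff : (x, t) ∈ S ↔ x ≤ K * r ^ (1 - p) := by
        rw [show 1 - p = -(p - 1) by ring, Real.rpow_neg hr.le, ← div_eq_mul_inv,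
          le_div_iff₀ (by positivity)]
        rfl
      by_cases hx : x ≤ K * r ^ (1 - p)
      · simp only [hH]
        rw [Set.indicator_of_mem (hiff.2 hx), Set.indicator_of_mem (Set.mem_Iic.2 hx),
          ← ofReal_norm, ENNReal.ofReal_mul (by norm_num),
          ENNReal.ofReal_mul (by norm_num), ENNReal.ofReal_pow (norm_nonneg _)]
        ring
      · simp only [hH]
        rw [Set.indicator_of_notMem (fun h => hx (hiff.1 h)), Set.indicator_of_notMem (by exact hx)]
    simp_rw [hH']
    rw [setLIntegral_indicator measurableSet_Iic, Set.inter_comm, Set.Ioi_inter_Iic,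
      lintegral_const_mul' _ _ ENNReal.ofReal_ne_top, lintegral_Ioc_rpow (by linarith) hX,
      ← ENNReal.ofReal_mul (by positivity), ← ENNReal.ofReal_mul (by
        have : 0 < q - 2 := by linarith
        positivity)]
    congr 1
    rw [show q - 3 + 1 = q - 2 by ring, Real.mul_rpow hK0.le (by positivity),
      ← Real.rpow_mul hr.le, show (1 - p) * (q - 2) = p - 2 by linarith,
      show p = (p - 2) + 2 by ring, Real.rpow_add hr, Real.rpow_two,
      show p - 2 + 2 - 2 = p - 2 by ring]
    ring
  -- Layer-cake formula, followed by Tonelli.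
  rw [e1, lintegral_rpow_eq_lintegral_meas_lt_mul (sqMeasure w)
    (Eventually.of_forall fun n => div_nonneg (norm_nonneg _) (h.weight_pos n).le)
    (measurable_of_countable _).aemeasurable (by linarith)]
  calc _ ≤ ENNReal.ofReal q * ∫⁻ x in Set.Ioi (0 : ℝ), ∫⁻ t, H x t ∂μ := by gcongr
    _ = ENNReal.ofReal q * ∫⁻ t, (∫⁻ x in Set.Ioi (0 : ℝ), H x t) ∂μ := by
        rw [lintegral_lintegral_swap hHm.aemeasurable]
    _ ≤ ENNReal.ofReal q * (ENNReal.ofReal (4 / (q - 2) * K ^ (q - 2)) * ENNReal.ofReal N) := by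
        simp_rw [e3]
        rw [lintegral_const_mul' _ _ ENNReal.ofReal_ne_top]
        gcongr
    _ = _ := by
        have : 0 < q - 2 := by linarith
        rw [← ENNReal.ofReal_mul (by positivity), ← ENNReal.ofReal_mul (by linarith)]
        congr 1
        rw [hK, Real.mul_rpow (by positivity) hN.le, show q - 1 = (q - 2) + 1 by ring,
          Real.rpow_add_one hN.ne']
        ring

end IsBoundedOrthonormal

theorem toReal_eLpNorm_rpow {α : Type*} [MeasurableSpace α] {μ : Measure α} {f : α → ℂ} {p : ℝ}
    (hp : 0 < p) (hf : MemLp f (ENNReal.ofReal p) μ) :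
    (eLpNorm f (ENNReal.ofReal p) μ).toReal ^ p = ∫ t, ‖f t‖ ^ p ∂μ := by
  have h0 : 0 ≤ ∫ t, ‖f t‖ ^ p ∂μ :=
    integral_nonneg fun t => Real.rpow_nonneg (norm_nonneg _) _
  rw [hf.eLpNorm_eq_integral_rpow_norm (by simpa using hp) ENNReal.ofReal_ne_top,
    ENNReal.toReal_ofReal hp.le, ENNReal.toReal_ofReal (Real.rpow_nonneg h0 _),
    ← Real.rpow_mul h0, inv_mul_cancel₀ hp.ne', Real.rpow_one]

theorem lintegral_ofReal_norm_rpow {α : Type*} [MeasurableSpace α] {μ : Measure α} {f : α → ℂ}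
    {p : ℝ} (hp : 0 < p) (hf : MemLp f (ENNReal.ofReal p) μ) :
    ∫⁻ t, ENNReal.ofReal (‖f t‖ ^ p) ∂μ
      = ENNReal.ofReal ((eLpNorm f (ENNReal.ofReal p) μ).toReal ^ p) := by
  rw [toReal_eLpNorm_rpow hp hf, ofReal_integral_eq_lintegral_ofReal]
  · simpa [ENNReal.toReal_ofReal hp.le] using
      hf.integrable_norm_rpow (by simpa using hp) ENNReal.ofReal_ne_top
  · exact Eventually.of_forall fun t => Real.rpow_nonneg (norm_nonneg _) _

theorem summable_and_tsum_le_of_tsum_ofReal_le {a : ℕ → ℝ} (ha : ∀ n, 0 ≤ a n) {X : ℝ}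
    (hX : 0 ≤ X) (h : ∑' n, ENNReal.ofReal (a n) ≤ ENNReal.ofReal X) :
    Summable a ∧ ∑' n, a n ≤ X := by
  have hs : Summable a := by
    have := ENNReal.summable_toReal (h.trans_lt ENNReal.ofReal_lt_top).ne
    simpa only [ENNReal.toReal_ofReal (ha _)] using this
  refine ⟨hs, ?_⟩
  rwa [← ENNReal.ofReal_tsum_of_nonneg ha hs, ENNReal.ofReal_le_ofReal_iff hX] at h

namespace IsBoundedOrthonormal

variable {α : Type*} [MeasurableSpace α] {μ : Measure α} {e : ℕ → α → ℝ} {w : ℕ → ℝ} {M : ℝ}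

/-- The interpolation constant contains `4/(q-2)` and is useless at `p = 2`; there the claim is
Bessel's inequality itself. -/
theorem exists_tsum_coeff_rpow_le [IsFiniteMeasure μ] (h : IsBoundedOrthonormal μ e w M)
    {p q : ℝ} (hp : 1 < p) (hp2 : p ≤ 2) (hpq : 1 / p + 1 / q = 1) :
    ∃ D : ℝ, 0 ≤ D ∧ ∀ f : α → ℂ, MemLp f (ENNReal.ofReal p) μ →
      ∑' n, ENNReal.ofReal ((w n ^ (1 / q - 1 / p) * ‖∫ t, f t * (e n t : ℂ) ∂μ‖) ^ q)
        ≤ ENNReal.ofReal (D * (eLpNorm f (ENNReal.ofReal p) μ).toReal ^ q) := by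
  have hM := h.bound_pos
  have hp0 : p ≠ 0 := by linarith
  have hq0 : q ≠ 0 := by
    rintro rfl
    rw [div_zero, add_zero, div_eq_one_iff_eq hp0] at hpq
    linarith
  have hpq' : p + q = p * q := by
    field_simp at hpq
    linarith
  rcases hp2.eq_or_lt with rfl | hp2
  · have hq : q = 2 := by linarith
    subst hq
    refine ⟨1, zero_le_one, fun f hf => ?_⟩
    rw [one_mul, ← lintegral_ofReal_norm_rpow two_pos hf]
    simp only [sub_self, Real.rpow_zero, one_mul, Real.rpow_two,
      ENNReal.ofReal_pow (norm_nonneg _), ofReal_norm]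
    exact h.tsum_enorm_coeff_sq_le hf.1
  · have hq : 2 < q := by
      by_contra hcon
      nlinarith
    have hq2 : 0 < q - 2 := by linarith
    refine ⟨q * (4 / (q - 2) * (2 * M) ^ (q - 2)), by positivity, fun f hf => ?_⟩
    set g := hf.1.mk f with hg
    have hfg : f =ᵐ[μ] g := hf.1.ae_eq_mk
    have hgm : Measurable g := hf.1.stronglyMeasurable_mk.measurable
    have hgL : MemLp g (ENNReal.ofReal p) μ := (memLp_congr_ae hfg).1 hf
    have hc : ∀ n, ∫ t, f t * (e n t : ℂ) ∂μ = ∫ t, g t * (e n t : ℂ) ∂μ := fun n =>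
      integral_congr_ae (by filter_upwards [hfg] with t ht; rw [ht])
    have hterm : ∀ n, (w n ^ (1 / q - 1 / p) * ‖∫ t, g t * (e n t : ℂ) ∂μ‖) ^ q
        = w n ^ 2 * (‖∫ t, g t * (e n t : ℂ) ∂μ‖ / w n) ^ q := by
      intro n
      have hw := h.weight_pos n
      rw [Real.mul_rpow (by positivity) (norm_nonneg _), Real.div_rpow (norm_nonneg _) hw.le,
        ← Real.rpow_mul hw.le, show (1 / q - 1 / p) * q = 2 - q by
          field_simp
          linarith, Real.rpow_sub hw, Real.rpow_two]
      ring
    simp_rw [hc, hterm]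
    rw [eLpNorm_congr_ae hfg]
    have hgi : Integrable g μ := hgL.integrable (by simpa using hp.le)
    -- The truncation height needs `N > 0`, so vanishing norm is treated apart. Otherwise `N =
    -- ‖g‖_p^p`, and `N^(q-1) = ‖g‖_p^q`.
    rcases (ENNReal.toReal_nonneg (a := eLpNorm g (ENNReal.ofReal p) μ)).eq_or_lt with h0 | h0
    · have h1 : eLpNorm g (ENNReal.ofReal p) μ = 0 := by
        rcases (ENNReal.toReal_eq_zero_iff _).1 h0.symm with h1 | h1
        · exact h1
        · exact absurd h1 hgL.2.ne
      rw [eLpNorm_eq_zero_iff hgL.1 (by simp; linarith)] at h1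
      have h2 : ∀ n, ∫ t, g t * (e n t : ℂ) ∂μ = 0 := fun n =>
        integral_eq_zero_of_ae (by filter_upwards [h1] with t ht; simp [ht])
      simp [h2, hq0]
    · have h1 := h.tsum_sq_mul_coeff_rpow_le (N := (eLpNorm g (ENNReal.ofReal p) μ).toReal ^ p)
        (by positivity) hgm hgi hp hq hpq (lintegral_ofReal_norm_rpow (by linarith) hgL).le
      rwa [← Real.rpow_mul h0.le, show p * (q - 1) = q by linarith] at h1

/-- A weighted Hausdorff–Young inequality for bounded orthonormal systems. -/
theorem exists_hausdorffYoung [IsFiniteMeasure μ] (h : IsBoundedOrthonormal μ e w M)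
    {p q : ℝ} (hp : 1 < p) (hp2 : p ≤ 2) (hpq : 1 / p + 1 / q = 1) :
    ∃ B : ℝ, 0 ≤ B ∧ ∀ f : α → ℂ, MemLp f (ENNReal.ofReal p) μ →
      Summable (fun n => (w n ^ (1 / q - 1 / p) * ‖∫ t, f t * (e n t : ℂ) ∂μ‖) ^ q) ∧
      (∑' n, (w n ^ (1 / q - 1 / p) * ‖∫ t, f t * (e n t : ℂ) ∂μ‖) ^ q) ^ (1 / q)
        ≤ B * (eLpNorm f (ENNReal.ofReal p) μ).toReal := by
  obtain ⟨D, hD, hDf⟩ := h.exists_tsum_coeff_rpow_le hp hp2 hpq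
  have hq0 : 0 < q := by
    have : 1 / p < 1 := by rw [div_lt_one (by linarith)]; exact hp
    exact one_div_pos.1 (by linarith)
  refine ⟨D ^ (1 / q), by positivity, fun f hf => ?_⟩
  have hterm : ∀ n, 0 ≤ (w n ^ (1 / q - 1 / p) * ‖∫ t, f t * (e n t : ℂ) ∂μ‖) ^ q := fun n => by
    have := h.weight_pos n
    positivity
  obtain ⟨h1, h2⟩ := summable_and_tsum_le_of_tsum_ofReal_le hterm (by positivity) (hDf f hf)
  refine ⟨h1, (Real.rpow_le_rpow (tsum_nonneg hterm) h2 (by positivity)).trans_eq ?_⟩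
  rw [Real.mul_rpow hD (by positivity), ← Real.rpow_mul ENNReal.toReal_nonneg,
    mul_one_div_cancel hq0.ne', Real.rpow_one]

/-! ### Duality: norms of finite sums and convergence of series. -/

theorem integral_sum_mul (h : IsBoundedOrthonormal μ e w M) (φ : ℕ → ℂ) (s : Finset ℕ)
    {f : α → ℂ} (hf : Integrable f μ) :
    ∫ t, (∑ n ∈ s, φ n * (e n t : ℂ)) * f t ∂μ
      = ∑ n ∈ s, φ n * ∫ t, f t * (e n t : ℂ) ∂μ := by
  simp_rw [← integral_const_mul]
  rw [← integral_finsetSum _ fun n _ => (h.integrable_mul hf n).const_mul _]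
  refine integral_congr_ae (Eventually.of_forall fun t => ?_)
  simp only [Finset.sum_mul]
  exact Finset.sum_congr rfl fun n _ => by ring

theorem memLp_sum [IsFiniteMeasure μ] (h : IsBoundedOrthonormal μ e w M) (φ : ℕ → ℂ)
    (s : Finset ℕ) (p : ℝ≥0∞) : MemLp (fun t => ∑ n ∈ s, φ n * (e n t : ℂ)) p μ :=
  memLp_finsetSum s fun n _ => (h.memLp_ofReal n p).const_mul (φ n)

theorem coeff_sum [IsFiniteMeasure μ] (h : IsBoundedOrthonormal μ e w M) (φ : ℕ → ℂ)
    (s : Finset ℕ) (k : ℕ) :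
    ∫ t, (∑ n ∈ s, φ n * (e n t : ℂ)) * (e k t : ℂ) ∂μ = if k ∈ s then φ k else 0 := by
  rw [h.integral_sum_mul φ s ((h.memLp_ofReal k 1).integrable le_rfl)]
  have : ∀ n, ∫ t, (e k t : ℂ) * (e n t : ℂ) ∂μ = if k = n then 1 else 0 := by
    intro n
    simp_rw [← Complex.ofReal_mul]
    rw [integral_complex_ofReal, h.integral_mul]
    split_ifs <;> simp
  simp [this]

/-- The dual form of the weighted Hausdorff–Young inequality, for finite sums. -/
theorem eLpNorm_sum_le [IsFiniteMeasure μ] (h : IsBoundedOrthonormal μ e w M)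
    {p q B : ℝ} (hp : 1 < p) (hq : 2 ≤ q) (hpq : 1 / p + 1 / q = 1) (hB0 : 0 ≤ B)
    (hB : ∀ f : α → ℂ, MemLp f (ENNReal.ofReal p) μ →
      Summable (fun n => (w n ^ (1 / q - 1 / p) * ‖∫ t, f t * (e n t : ℂ) ∂μ‖) ^ q) ∧
      (∑' n, (w n ^ (1 / q - 1 / p) * ‖∫ t, f t * (e n t : ℂ) ∂μ‖) ^ q) ^ (1 / q)
        ≤ B * (eLpNorm f (ENNReal.ofReal p) μ).toReal) (φ : ℕ → ℂ) (s : Finset ℕ) :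
    (eLpNorm (fun t => ∑ n ∈ s, φ n * (e n t : ℂ)) (ENNReal.ofReal q) μ).toReal
      ≤ B * (∑ n ∈ s, (w n ^ (1 / p - 1 / q) * ‖φ n‖) ^ p) ^ (1 / p) := by
  have hp0 : 0 < p := by linarith
  have hq0 : 0 < q := by linarith
  have hpq' : p + q = p * q := by
    field_simp at hpq
    linarith
  set g : α → ℂ := fun t => ∑ n ∈ s, φ n * (e n t : ℂ) with hg
  have hgm : Measurable g := Finset.measurable_fun_sum s fun n _ =>
    (Complex.measurable_ofReal.comp (h.measurable n)).const_mul (φ n)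
  have hgL : ∀ r, MemLp g r μ := fun r => h.memLp_sum φ s r
  set G := (eLpNorm g (ENNReal.ofReal q) μ).toReal with hG
  have hG0 : 0 ≤ G := ENNReal.toReal_nonneg
  have hGq : G ^ q = ∫ t, ‖g t‖ ^ q ∂μ := toReal_eLpNorm_rpow hq0 (hgL _)
  -- The extremal function in Hölder's inequality: `g ψ = |g|^q` and `|ψ|^p = |g|^q`. It is bounded
  -- because `g` is, so the hypothesis applies to it.
  set ψ : α → ℂ := fun t => (starRingEnd ℂ) (g t) * ((‖g t‖ ^ (q - 2) : ℝ) : ℂ) with hψ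
  have hψm : Measurable ψ := by fun_prop
  have hψn : ∀ t, ‖ψ t‖ = ‖g t‖ ^ (q - 1) := by
    intro t
    have : 0 ≤ ‖g t‖ ^ (q - 2) := by positivity
    rw [hψ, norm_mul, RCLike.norm_conj, Complex.norm_real, Real.norm_of_nonneg this,
      ← Real.rpow_one_add' (norm_nonneg _) (by linarith)]
    congr 1
    ring
  have hψg : ∀ t, g t * ψ t = ((‖g t‖ ^ q : ℝ) : ℂ) := by
    intro t
    rw [hψ, ← mul_assoc, Complex.mul_conj, ← Complex.ofReal_mul, Complex.normSq_eq_norm_sq,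
      ← Real.rpow_two, ← Real.rpow_add' (norm_nonneg _) (by linarith)]
    congr 2
    ring
  have hψL : ∀ r, MemLp ψ r μ := by
    intro r
    obtain ⟨C, hC⟩ : ∃ C : ℝ, ∀ᵐ t ∂μ, ‖g t‖ ≤ C := by
      refine ⟨∑ n ∈ s, ‖φ n‖ * (M * w n), ?_⟩
      have : ∀ᵐ t ∂μ, ∀ n, |e n t| ≤ M * w n := ae_all_iff.2 h.abs_le
      filter_upwards [this] with t ht
      refine (norm_sum_le _ _).trans (Finset.sum_le_sum fun n _ => ?_)
      rw [norm_mul, Complex.norm_real, Real.norm_eq_abs]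
      gcongr
      exact ht n
    refine MemLp.of_bound (C := C ^ (q - 1)) hψm.aestronglyMeasurable ?_
    filter_upwards [hC] with t ht
    rw [hψn]
    exact Real.rpow_le_rpow (norm_nonneg _) ht (by linarith)
  have hψp : (eLpNorm ψ (ENNReal.ofReal p) μ).toReal = G ^ (q - 1) := by
    have h1 := toReal_eLpNorm_rpow hp0 (hψL (ENNReal.ofReal p))
    have h2 : ∀ t, ‖ψ t‖ ^ p = ‖g t‖ ^ q := fun t => by
      rw [hψn, ← Real.rpow_mul (norm_nonneg _)]
      congr 1
      linarith
    simp_rw [h2] at h1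
    rw [← hGq, show q = (q - 1) * p by linarith, Real.rpow_mul hG0] at h1
    exact (Real.rpow_left_inj ENNReal.toReal_nonneg (by positivity) hp0.ne').1 h1
  obtain ⟨hs, hle⟩ := hB ψ (hψL _)
  rw [hψp] at hle
  set c : ℕ → ℂ := fun n => ∫ t, ψ t * (e n t : ℂ) ∂μ with hc
  have hpair : (((G ^ q : ℝ)) : ℂ) = ∑ n ∈ s, φ n * c n := by
    rw [hc, ← h.integral_sum_mul φ s ((hψL 1).integrable le_rfl), hGq, ← integral_complex_ofReal]
    exact integral_congr_ae (Eventually.of_forall fun t => (hψg t).symm)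
  set S := (∑ n ∈ s, (w n ^ (1 / p - 1 / q) * ‖φ n‖) ^ p) ^ (1 / p) with hS
  have hw := fun n => h.weight_pos n
  have hnn : ∀ n, 0 ≤ w n ^ (1 / p - 1 / q) * ‖φ n‖ := fun n => by have := hw n; positivity
  have hnn' : ∀ n, 0 ≤ w n ^ (1 / q - 1 / p) * ‖c n‖ := fun n => by have := hw n; positivity
  have hS0 : 0 ≤ S := Real.rpow_nonneg (Finset.sum_nonneg fun n _ => Real.rpow_nonneg (hnn n) _) _
  have hmain : G ^ q ≤ S * (B * G ^ (q - 1)) := by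
    calc G ^ q = ‖∑ n ∈ s, φ n * c n‖ := by
          rw [← hpair, Complex.norm_real, Real.norm_of_nonneg (by positivity)]
      _ ≤ ∑ n ∈ s, ‖φ n * c n‖ := norm_sum_le _ _
      _ = ∑ n ∈ s, (w n ^ (1 / p - 1 / q) * ‖φ n‖) * (w n ^ (1 / q - 1 / p) * ‖c n‖) := by
          refine Finset.sum_congr rfl fun n _ => ?_
          rw [mul_mul_mul_comm, ← Real.rpow_add (hw n), norm_mul]
          simp
      _ ≤ S * (∑ n ∈ s, (w n ^ (1 / q - 1 / p) * ‖c n‖) ^ q) ^ (1 / q) := by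
          have := Real.inner_le_Lp_mul_Lq s (fun n => w n ^ (1 / p - 1 / q) * ‖φ n‖)
            (fun n => w n ^ (1 / q - 1 / p) * ‖c n‖) (p := p) (q := q)
            (Real.holderConjugate_iff.2 ⟨hp, by simpa using hpq⟩)
          simpa only [abs_of_nonneg (hnn _), abs_of_nonneg (hnn' _)] using this
      _ ≤ S * (B * G ^ (q - 1)) := by
          refine mul_le_mul_of_nonneg_left (le_trans ?_ hle) hS0
          refine Real.rpow_le_rpow (Finset.sum_nonneg fun n _ => Real.rpow_nonneg (hnn' n) _) ?_
            (by positivity)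
          exact hs.sum_le_tsum s fun n _ => Real.rpow_nonneg (hnn' n) _
  -- Dividing the main inequality by `G^(q-1)` needs `G > 0`.
  rcases hG0.eq_or_lt with h0 | h0
  · rw [← h0]
    positivity
  · have h1 : G ^ q = G * G ^ (q - 1) := by
      rw [← Real.rpow_one_add' hG0 (by linarith)]
      congr 1
      ring
    rw [h1] at hmain
    refine le_of_mul_le_mul_right (hmain.trans_eq ?_) (Real.rpow_pos_of_pos h0 (q - 1))
    ring

/-- The dual form of the weighted Hausdorff–Young inequality, for series. -/
theorem exists_tendsto_of_summable [IsFiniteMeasure μ] (h : IsBoundedOrthonormal μ e w M)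
    {p q B : ℝ} (hp : 1 < p) (hq : 2 ≤ q) (hpq : 1 / p + 1 / q = 1) (hB0 : 0 ≤ B)
    (hB : ∀ f : α → ℂ, MemLp f (ENNReal.ofReal p) μ →
      Summable (fun n => (w n ^ (1 / q - 1 / p) * ‖∫ t, f t * (e n t : ℂ) ∂μ‖) ^ q) ∧
      (∑' n, (w n ^ (1 / q - 1 / p) * ‖∫ t, f t * (e n t : ℂ) ∂μ‖) ^ q) ^ (1 / q)
        ≤ B * (eLpNorm f (ENNReal.ofReal p) μ).toReal) (φ : ℕ → ℂ)
    (hφ : Summable fun n => (w n ^ (1 / p - 1 / q) * ‖φ n‖) ^ p) :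
    ∃ f : α → ℂ, MemLp f (ENNReal.ofReal q) μ ∧
      Tendsto (fun N : ℕ => eLpNorm
        (fun t => (∑ n ∈ Finset.range (N + 1), φ n * (e n t : ℂ)) - f t) (ENNReal.ofReal q) μ)
        atTop (𝓝 0) ∧
      (∀ n, ∫ t, f t * (e n t : ℂ) ∂μ = φ n) ∧
      (eLpNorm f (ENNReal.ofReal q) μ).toReal
        ≤ B * (∑' n, (w n ^ (1 / p - 1 / q) * ‖φ n‖) ^ p) ^ (1 / p) := by
  have hp0 : 0 < p := by linarith
  have hq1 : 1 ≤ ENNReal.ofReal q := by simpa using (by linarith : 1 ≤ q)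
  have : Fact (1 ≤ ENNReal.ofReal q) := ⟨hq1⟩
  set a : ℕ → ℝ := fun n => (w n ^ (1 / p - 1 / q) * ‖φ n‖) ^ p with ha
  have ha0 : ∀ n, 0 ≤ a n := fun n => by have := h.weight_pos n; positivity
  have hL := fun s : Finset ℕ => h.memLp_sum φ s (ENNReal.ofReal q)
  set u : ℕ → Lp ℂ (ENNReal.ofReal q) μ := fun N => (hL (Finset.range (N + 1))).toLp with hu
  -- The finite-sum bound applied to a block of the series is dominated by a tail of the convergent
  -- sum, which gives the Cauchy property.
  have hdist : ∀ n k, n ≤ k → dist (u n) (u k) ≤ B * (∑' i, a (i + (n + 1))) ^ (1 / p) := by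
    intro n k hnk
    have h1 : u k - u n = (hL (Finset.Ico (n + 1) (k + 1))).toLp := by
      rw [hu, ← MemLp.toLp_sub]
      congr 1
      ext t
      rw [Finset.sum_Ico_eq_sub _ (by omega)]
      rfl
    rw [dist_comm, dist_eq_norm, h1, Lp.norm_toLp]
    refine (h.eLpNorm_sum_le hp hq hpq hB0 hB φ _).trans ?_
    refine mul_le_mul_of_nonneg_left (Real.rpow_le_rpow (Finset.sum_nonneg fun i _ => ha0 i) ?_
      (by positivity)) hB0
    rw [Finset.sum_Ico_eq_sum_range]
    simp_rw [add_comm (n + 1)]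
    exact ((summable_nat_add_iff (n + 1)).2 hφ).sum_le_tsum _ fun i _ => ha0 _
  have hlim : Tendsto (fun n : ℕ => B * (∑' i, a (i + (n + 1))) ^ (1 / p)) atTop (𝓝 0) := by
    have h1 := (tendsto_sum_nat_add a).comp (tendsto_add_atTop_nat 1)
    have h2 := (h1.rpow_const (p := 1 / p) (Or.inr (by positivity))).const_mul B
    rwa [Real.zero_rpow (by positivity), mul_zero] at h2
  obtain ⟨F, hF⟩ := cauchySeq_tendsto_of_complete (cauchySeq_of_le_tendsto_0' _ hdist hlim)
  have hconv : Tendsto (fun N : ℕ => eLpNorm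
      (fun t => (∑ n ∈ Finset.range (N + 1), φ n * (e n t : ℂ)) - F t) (ENNReal.ofReal q) μ)
      atTop (𝓝 0) := by
    rw [Lp.tendsto_Lp_iff_tendsto_eLpNorm'] at hF
    refine hF.congr fun N => eLpNorm_congr_ae ?_
    filter_upwards [(hL (Finset.range (N + 1))).coeFn_toLp] with t ht
    simp only [Pi.sub_apply, hu, ht]
  have hFL := Lp.memLp F
  refine ⟨F, hFL, hconv, fun n => ?_, ?_⟩
  · have hFi : Integrable F μ := hFL.integrable hq1
    -- Coefficients are continuous for the L¹ norm, hence for the L^q norm on a finite measure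
    -- space; those of the partial sums are eventually `φ n`.
    have hbound : ∀ N, n ≤ N → ‖φ n - ∫ t, F t * (e n t : ℂ) ∂μ‖ₑ
        ≤ ENNReal.ofReal (M * w n) * (eLpNorm
          (fun t => (∑ n ∈ Finset.range (N + 1), φ n * (e n t : ℂ)) - F t) (ENNReal.ofReal q) μ
          * μ Set.univ ^ (1 / (1 : ℝ≥0∞).toReal - 1 / (ENNReal.ofReal q).toReal)) := by
      intro N hN
      have h1 := h.coeff_sum φ (Finset.range (N + 1)) n
      rw [if_pos (Finset.mem_range.2 (by omega))] at h1
      have hPi := (h.memLp_sum φ (Finset.range (N + 1)) 1).integrable le_rfl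
      rw [← h1, ← integral_sub (h.integrable_mul hPi n) (h.integrable_mul hFi n)]
      simp_rw [← sub_mul]
      refine (h.enorm_coeff_le _ n).trans ?_
      rw [← eLpNorm_one_eq_lintegral_enorm]
      gcongr
      exact eLpNorm_le_eLpNorm_mul_rpow_measure_univ hq1 (hPi.sub hFi).1
    have hlim0 := ENNReal.Tendsto.const_mul (a := ENNReal.ofReal (M * w n))
      (ENNReal.Tendsto.mul_const (b := μ Set.univ
        ^ (1 / (1 : ℝ≥0∞).toReal - 1 / (ENNReal.ofReal q).toReal)) hconv (Or.inr
        (ENNReal.rpow_ne_top_of_nonneg (by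
          rw [ENNReal.toReal_ofReal (by linarith), ENNReal.toReal_one, div_one, sub_nonneg,
            div_le_one (by linarith)]
          linarith) (measure_ne_top μ _)))) (Or.inr ENNReal.ofReal_ne_top)
    rw [zero_mul, mul_zero] at hlim0
    have h2 := ge_of_tendsto hlim0 (eventually_atTop.2 ⟨n, hbound⟩)
    rw [nonpos_iff_eq_zero, enorm_eq_zero, sub_eq_zero] at h2
    exact h2.symm
  · rw [← Lp.norm_def]
    refine le_of_tendsto hF.norm (Eventually.of_forall fun N => ?_)
    rw [hu, Lp.norm_toLp]
    refine (h.eLpNorm_sum_le hp hq hpq hB0 hB φ _).trans ?_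
    exact mul_le_mul_of_nonneg_left (Real.rpow_le_rpow (Finset.sum_nonneg fun i _ => ha0 i)
      (hφ.sum_le_tsum _ fun i _ => ha0 i) (by positivity)) hB0

end IsBoundedOrthonormal

/-! ### Application to the generalized Gegenbauer system. -/

theorem exists_isBoundedOrthonormal {l m : ℝ} (hl : -1 / 2 < l) (hm : 0 ≤ m) :
    ∃ M, IsBoundedOrthonormal (weightMeasure l m) (orthoPoly l m)
      (fun n => ((n : ℝ) + 1) ^ max l m) M := by
  obtain ⟨M, hM, h⟩ := exists_abs_orthoPoly_le hl hm
  refine ⟨M, fun n => (continuous_orthoPoly l m n).measurable, hM, fun n => by positivity,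
    fun n => ?_, integral_orthoPoly_mul_orthoPoly hl hm⟩
  filter_upwards [ae_weightMeasure_mem_Icc l m] with t ht
  exact h n t ht

end GenGegenbauer

end

theorem theorem3 (l m : ℝ) (hl : -1 / 2 < l) (hm : 0 ≤ m) :
    ∃ B : ℝ → ℝ,
      (∀ p p' : ℝ, 1 < p → p ≤ 2 → 1 / p + 1 / p' = 1 →
        ∀ f : ℝ → ℂ, MemLp f (ENNReal.ofReal p) (GenGegenbauer.weightMeasure l m) →
          Summable (fun n : ℕ =>
            (((n : ℝ) + 1) ^ ((1 / p' - 1 / p) * max l m)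
              * ‖GenGegenbauer.coeff l m f n‖) ^ p') ∧
          (∑' n : ℕ, (((n : ℝ) + 1) ^ ((1 / p' - 1 / p) * max l m)
              * ‖GenGegenbauer.coeff l m f n‖) ^ p') ^ (1 / p')
            ≤ B p * GenGegenbauer.weightedNorm l m p f) ∧
      (∀ q q' : ℝ, 2 ≤ q → 1 / q + 1 / q' = 1 →
        ∀ φ : ℕ → ℂ,
          Summable (fun n : ℕ =>
            (((n : ℝ) + 1) ^ ((1 / q' - 1 / q) * max l m) * ‖φ n‖) ^ q') →
          ∃ f : ℝ → ℂ,
            MemLp f (ENNReal.ofReal q) (GenGegenbauer.weightMeasure l m) ∧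
            Tendsto (fun N : ℕ =>
                eLpNorm (fun t => GenGegenbauer.partialSum l m φ N t - f t)
                  (ENNReal.ofReal q) (GenGegenbauer.weightMeasure l m))
              atTop (𝓝 0) ∧
            (∀ n : ℕ, GenGegenbauer.coeff l m f n = φ n) ∧
            GenGegenbauer.weightedNorm l m q f
              ≤ B q' * (∑' n : ℕ,
                (((n : ℝ) + 1) ^ ((1 / q' - 1 / q) * max l m) * ‖φ n‖) ^ q') ^ (1 / q')) := by
  obtain ⟨M, h⟩ := GenGegenbauer.exists_isBoundedOrthonormal hl hm
  have := GenGegenbauer.isFiniteMeasure_weightMeasure hl hm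
  have hpow : ∀ (n : ℕ) (r : ℝ), ((n : ℝ) + 1) ^ (r * max l m)
      = (((n : ℝ) + 1) ^ max l m) ^ r := fun n r => by
    rw [mul_comm, Real.rpow_mul (by positivity)]
  simp_rw [hpow]
  have key : ∀ p : ℝ, ∃ B : ℝ, 0 ≤ B ∧ ∀ p' : ℝ, 1 < p → p ≤ 2 → 1 / p + 1 / p' = 1 →
      ∀ f : ℝ → ℂ, MemLp f (ENNReal.ofReal p) (GenGegenbauer.weightMeasure l m) →
        Summable (fun n : ℕ => ((((n : ℝ) + 1) ^ max l m) ^ (1 / p' - 1 / p)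
          * ‖GenGegenbauer.coeff l m f n‖) ^ p') ∧
        (∑' n : ℕ, ((((n : ℝ) + 1) ^ max l m) ^ (1 / p' - 1 / p)
          * ‖GenGegenbauer.coeff l m f n‖) ^ p') ^ (1 / p')
          ≤ B * GenGegenbauer.weightedNorm l m p f := by
    intro p
    by_cases hp : 1 < p ∧ p ≤ 2
    · obtain ⟨B, hB0, hB⟩ := h.exists_hausdorffYoung hp.1 hp.2
        (q := (1 - 1 / p)⁻¹) (by rw [one_div (_⁻¹), inv_inv]; ring)
      refine ⟨B, hB0, fun p' _ _ hpp => ?_⟩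
      have : p' = (1 - 1 / p)⁻¹ := by
        rw [← eq_sub_of_add_eq' hpp, one_div, inv_inv]
      subst this
      exact hB
    · exact ⟨0, le_rfl, fun p' h1 h2 => absurd ⟨h1, h2⟩ hp⟩
  choose B hB0 hB using key
  refine ⟨B, fun p p' h1 h2 h3 => hB p p' h1 h2 h3, fun q q' hq hqq φ hφ => ?_⟩
  have hq2 : 1 / q ≤ 1 / 2 := one_div_le_one_div_of_le two_pos hq
  have hq0 : 0 < 1 / q := by positivity
  have hq'0 : 0 < q' := one_div_pos.1 (by linarith)
  have hq'1 : 1 < q' := (one_div_lt_one_div hq'0 one_pos).1 (by linarith)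
  have hq'2 : q' ≤ 2 := (one_div_le_one_div two_pos hq'0).1 (by linarith)
  have hqq' : 1 / q' + 1 / q = 1 := by rw [add_comm]; exact hqq
  exact h.exists_tendsto_of_summable hq'1 hq hqq' (hB0 q') (hB q' q hq'1 hq'2 hqq') φ hφ
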